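/- All posets are finite and nonempty, and logarithms are natural. **Random posets.** Write $\mathcal P(n)$ for the power set of $[n]$ ordered by inclusion, and for $p\in[0,1]$ let $\mathcal P(n,p)$ be the random induced subposet of $\mathcal P(n)$ obtained by keeping each element of $\mathcal P(n)$ independently with probability $p$. An event depending on $n$ holds *w.h.p.* if its probability tends to $1$ as $n\to\infty$. A *copy* of a poset $P$ in a poset $R$ is the image of an injective order-preserving map $P\to R$ (it need not be induced). Write $R\to(P,Q)$ if every colouring of the elements of $R$ with colours $1,2$ yields a copy of $P$ all of whose elements have colour $1$ or a copy of $Q$ all of whose elements have colour $2$; otherwise write $R\not\to(P,Q)$. **Ramsey exponents.** Put $$c_{\mathrm{Ram}^-}(P,Q)=\sup\{c>0:\ \mathcal P(n,e^{-cn})\to(P,Q)\text{ w.h.p.}\},\qquad c_{\mathrm{Ram}^+}(P,Q)=\inf\{c>0:\ \mathcal P(n,e^{-cn})\not\to(P,Q)\text{ w.h.p.}\}.$$ If these are equal, the critical Ramsey exponent $c_{\mathrm{Ram}}(P,Q)$ of $(P,Q)$ is said to exist and is their common value. **The exponent $c_\star(P)$.** Let $\mathcal A(P)$ be the set of antichains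 of $P$, including $\emptyset$. For $Q\subseteq P$ and $S\in\mathcal A(P)$, let the shadow $\partial_Q S\in\mathcal A(Q)$ be the set of minimal elements of $\{y\in Q:\ x\le_P y\text{ for some }x\in S\}$. For $\alpha\colon\mathcal A(P)\to[0,\infty)$ with $\sum_S\alpha_S=1$, let $(\partial_Q\alpha)_T=\sum_{S:\,\partial_QS=T}\alpha_S$ for $T\in\mathcal A(Q)$, and let $H(\beta)=-\sum_T\beta_T\log\beta_T$ (with $0\log 0=0$). Then $$c_\star(P)=\sup\Bigl\{c\ge 0:\ \exists\,\alpha\ \ \forall\,\emptyset\neq Q\subseteq P,\ \ c\le \frac{H(\partial_Q\alpha)}{|Q|}\Bigr\}.$$ **Theorem.** Let $V$ be the poset on $\{A,B,C\}$ whose strict relations are $A<B$ and $A<C$, let $\Lambda$ be its reverse, and let $T_2$ be the binary tree of height $3$, that is, the poset on $\{A,B,C,D,E,F,G\}$ whose order is generated by $A<B$, $B<C$, $B<D$, $A<E$, $E<F$, $E<G$. Then the critical Ramsey exponents of $(V,V)$ and of $(\Lambda,\Lambda)$ exist, and $$c_{\mathrm{Ram}}(V,V)=c_{\mathrm{Ram}}(\Lambda,\Lambda)=c_\star(T_2).$$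 -/

import Mathlib

open MeasureTheory Filter Topology

noncomputable section

namespace RandomPoset

/-! ### The posets `V`, `Λ` and `T₂` -/

/-- The underlying set `{A, B, C}` of the poset `V = C(1, 2)`. -/
inductive Vee : Type
  | A | B | C
  deriving DecidableEq

namespace Vee

instance : Fintype Vee := ⟨{A, B, C}, fun x => by cases x <;> decide⟩

/-- The order of `V` : `A < B` and `A < C`. -/
def le : Vee → Vee → Bool
  | A, _ => true
  | B, B => true
  | C, C => true
  | _, _ => false

instance : PartialOrder Vee where
  le x y := le x y = true
  le_refl := by decide
  le_trans := by decide
  le_antisymm := by decide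

end Vee

/-- The poset `Λ`, the reverse of `V`. -/
abbrev Wedge : Type := Veeᵒᵈ

/-- The underlying set `{A, …, G}` of the binary tree `T₂` of height `3` : the root `A`, its two
children `B` and `E`, the two children `C`, `D` of `B` and the two children `F`, `G` of `E`. -/
inductive BinTree : Type
  | A | B | C | D | E | F | G
  deriving DecidableEq

namespace BinTree

instance : Fintype BinTree := ⟨{A, B, C, D, E, F, G}, fun x => by cases x <;> decide⟩

/-- The order of `T₂`, generated by `A < B < C, D` and `A < E < F, G`. -/
def le : BinTree → BinTree → Bool
  | A, _ => true
  | B, B => true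
  | B, C => true
  | B, D => true
  | C, C => true
  | D, D => true
  | E, E => true
  | E, F => true
  | E, G => true
  | F, F => true
  | G, G => true
  | _, _ => false

instance : PartialOrder BinTree where
  le x y := le x y = true
  le_refl := by decide
  le_trans := by decide
  le_antisymm := by decide

end BinTree

/-! ### The critical exponent of a finite poset -/

section CriticalExponent

variable {P : Type*} [Fintype P] [PartialOrder P]

open Classical in
/-- The antichains (including the empty one) of the induced subposet on `Q ⊆ P`. -/
def antichains (Q : Finset P) : Finset (Finset P) :=
  Q.powerset.filter fun S => IsAntichain (· ≤ ·) (S : Set P)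

open Classical in
/-- The (upper) shadow in `Q` of `S` : the minimal elements of `Q` among those that lie above some
element of `S`. -/
def shadow (Q S : Finset P) : Finset P :=
  Q.filter fun y => (∃ x ∈ S, x ≤ y) ∧ ∀ z ∈ Q, z < y → ∀ x ∈ S, ¬ x ≤ z

open Classical in
/-- The weighting of the antichains of `Q` induced by a weighting of the antichains of `P`. -/
def inducedWeighting (Q : Finset P) (α : antichains (Finset.univ : Finset P) → ℝ)
    (T : antichains Q) : ℝ :=
  ∑ S : antichains (Finset.univ : Finset P), if shadow Q (S : Finset P) = T then α S else 0

/-- The entropy `∑ -αⱼ log αⱼ`, with `0 log 0 = 0`. -/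
def entropy {ι : Type*} [Fintype ι] (α : ι → ℝ) : ℝ := ∑ j, Real.negMulLog (α j)

/-- The critical exponent of `Q` in `P` with respect to the weighting `α`. -/
def criticalExponentIn (α : antichains (Finset.univ : Finset P) → ℝ) (Q : Finset P) : ℝ :=
  entropy (inducedWeighting Q α) / (Q.card : ℝ)

variable (P) in
/-- The set of `c ≥ 0` for which some weighting of the antichains of `P` gives every nonempty
`Q ⊆ P` a critical exponent at least `c`. -/
def admissibleExponents : Set ℝ :=
  {c | 0 ≤ c ∧ ∃ α ∈ stdSimplex ℝ (antichains (Finset.univ : Finset P)),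
    ∀ Q : Finset P, Q.Nonempty → c ≤ criticalExponentIn α Q}

variable (P) in
/-- The critical exponent `c_⋆(P)` of a finite (nonempty) poset `P`. -/
def criticalExponent : ℝ := sSup (admissibleExponents P)

variable (P) in
/-- For nonempty `P` the supremum that defines `c_⋆(P)` is a genuine one. -/
theorem isLUB_criticalExponent [Nonempty P] :
    IsLUB (admissibleExponents P) (criticalExponent P) := by
  classical
  have hmem (α : antichains (Finset.univ : Finset P) → ℝ)
      (hα : α ∈ stdSimplex ℝ (antichains (Finset.univ : Finset P))) (Q : Finset P)
      (T : antichains Q) : 0 ≤ inducedWeighting Q α T ∧ inducedWeighting Q α T ≤ 1 := by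
    constructor
    · refine Finset.sum_nonneg fun S _ => ?_
      split_ifs
      exacts [hα.1 S, le_rfl]
    · rw [← hα.2]
      refine Finset.sum_le_sum fun S _ => ?_
      split_ifs
      exacts [le_rfl, hα.1 S]
  apply isLUB_csSup
  · have h0 : (∅ : Finset P) ∈ antichains (Finset.univ : Finset P) := by simp [antichains]
    refine ⟨0, le_rfl, _, single_mem_stdSimplex ℝ
      (⟨∅, h0⟩ : antichains (Finset.univ : Finset P)), fun Q _ => ?_⟩
    refine div_nonneg (Finset.sum_nonneg fun T _ => ?_) (Nat.cast_nonneg _)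
    have h := hmem _ (single_mem_stdSimplex ℝ
      (⟨∅, h0⟩ : antichains (Finset.univ : Finset P))) Q T
    exact Real.negMulLog_nonneg h.1 h.2
  · refine ⟨(∑ _T : antichains (Finset.univ : Finset P), (1 : ℝ)) /
      ((Finset.univ : Finset P).card : ℝ), ?_⟩
    rintro c ⟨-, α, hα, h⟩
    refine (h Finset.univ Finset.univ_nonempty).trans ?_
    refine div_le_div_of_nonneg_right (Finset.sum_le_sum fun T _ => ?_) (Nat.cast_nonneg _)
    have h1 := hmem α hα _ T
    have h2 := Real.negMulLog_le_one_sub_self h1.1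
    linarith [h1.1]

end CriticalExponent

/-! ### The random poset `𝒫(n, p)` and the Ramsey property -/

/-- `R → (P, Q)` : every `2`-colouring of `R` has a copy of `P` in the first colour (`true`) or a
copy of `Q` in the second (`false`). A copy is the image of an injective, order preserving
map; it need not be induced. -/
def IsRamsey (P Q R : Type*) [PartialOrder P] [PartialOrder Q] [PartialOrder R] : Prop :=
  ∀ χ : R → Bool,
    (∃ φ : P →o R, Function.Injective φ ∧ ∀ x, χ (φ x) = true) ∨
    (∃ φ : Q →o R, Function.Injective φ ∧ ∀ x, χ (φ x) = false)

/-- The probability `e ^ (-c n)`. -/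
def retainProb (c : ℝ) (hc : 0 < c) (n : ℕ) : unitInterval :=
  ⟨Real.exp (-c * n), (Real.exp_pos _).le, Real.exp_le_one_iff.2 <|
    mul_nonpos_of_nonpos_of_nonneg (neg_nonpos.2 hc.le) n.cast_nonneg⟩

/-- The law of `𝒫(n, p)` : the random set of subsets of an `n`-element set that contains each
subset independently with probability `p`. A sample `R` is ordered by inclusion of its elements. -/
def randomPoset (n : ℕ) (p : unitInterval) : Measure (Set (Finset (Fin n))) :=
  ProbabilityTheory.setBernoulli Set.univ p

/-- The property `E n` of the random poset `𝒫(n, e ^ (-c n))` holds with high probability. -/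
def HoldsWhp (c : ℝ) (hc : 0 < c) (E : ∀ n : ℕ, Set (Set (Finset (Fin n)))) : Prop :=
  Tendsto (fun n : ℕ => (randomPoset n (retainProb c hc n)).real (E n)) atTop (𝓝 1)

section RamseyExponents

variable (P Q : Type*) [PartialOrder P] [PartialOrder Q]

/-- The `c > 0` such that `𝒫(n, e ^ (-c n)) → (P, Q)` with high probability. -/
def ramseySet : Set ℝ :=
  {c | ∃ hc : 0 < c, HoldsWhp c hc fun _ => {R | IsRamsey P Q R}}

/-- The `c > 0` such that `𝒫(n, e ^ (-c n)) ↛ (P, Q)` with high probability. -/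
def nonRamseySet : Set ℝ :=
  {c | ∃ hc : 0 < c, HoldsWhp c hc fun _ => {R | ¬ IsRamsey P Q R}}

/-- The critical Ramsey exponent of `(P, Q)` exists and equals `c` : the lower Ramsey exponent
(the supremum of `ramseySet P Q`) and the upper one (the infimum of `nonRamseySet P Q`) both
exist and are equal to `c`. -/
def IsCriticalRamseyExponent (c : ℝ) : Prop :=
  IsLUB (ramseySet P Q) c ∧ IsGLB (nonRamseySet P Q) c

end RamseyExponents

end RandomPoset

end

/-! An order-preserving map `φ` from `P` to the power set of `[n]` is the same as a sequence of `n`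
antichains of `P`: coordinate `i` records the minimal `x` with `i ∈ φ x`. The empirical distribution
of the sequence is a weighting `α`, the restriction of `φ` to `Q ⊆ P` has the induced weighting `∂_Q
α`, and up to polynomial factors a given induced weighting is shared by at most `exp (n H(∂_Q α))`
restrictions. This makes `c_⋆(P)` the threshold for containing `P`. Above it, every weighting leaves
some `Q` too rare to appear, and only polynomially many weightings occur (`holdsWhp_not_hasCopy`).
Below it, the second moment method applies to copies counted with product weight `α ^ n` and
restricted to typical sequences (`holdsWhp_hasCopy`).

For the Ramsey property, every 2-colouring of `T₂` has a monochromatic `V`, so containing `T₂`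
suffices. Conversely, colour from the top, giving an element the first colour unless two elements
above it already have it. The first colour then contains no `V`. A `V` in the second colour has two
upper elements, each below two elements of the first colour; these two pairs are disjoint, share one
element or coincide, giving `T₂`, `sharedTree` or `doubleTree` (`IsRamsey.binTree_or`).

The two degenerate configurations have 14 up-sets on 6 elements and 8 up-sets on 5, so by a union
bound they are absent beyond the exponents `log 14 / 6` and `log 8 / 5`. An explicit weighting shows
that `c_⋆(T₂)` is at least the larger of these, `log 14 / 6` (`log_fourteen_le_criticalExponent`),
so above `c_⋆(T₂)` all three configurations are absent. Complementation reverses the order and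
preserves the law, which settles `Λ`. -/

namespace RandomPoset

/-! ### The law of the random poset and the second moment inequality -/

theorem randomPoset_real_superset {n : ℕ} (p : unitInterval) (F : Finset (Finset (Fin n))) :
    (randomPoset n p).real {R | (F : Set (Finset (Fin n))) ⊆ R} = (p : ℝ) ^ F.card := by
  have h : (randomPoset n p) {R | (F : Set (Finset (Fin n))) ⊆ R} =
      (unitInterval.toNNReal p : ENNReal) ^ F.card := by
    have hs : (fun q : Finset (Fin n) → Prop => {i | q i}) ⁻¹'
        {R | (F : Set (Finset (Fin n))) ⊆ R} = Set.pi F (fun _ => {True}) := by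
      ext q
      simp [Set.subset_def, Set.mem_pi]
    rw [randomPoset, ProbabilityTheory.setBernoulli_apply', hs, Measure.infinitePi_pi]
    · simp
    · intro i _
      exact .of_discrete
  rw [measureReal_def, h]
  simp

instance {n : ℕ} (p : unitInterval) : IsProbabilityMeasure (randomPoset n p) := by
  unfold randomPoset; infer_instance

theorem randomPoset_real_singleton_image_compl {n : ℕ} (p : unitInterval)
    (R : Set (Finset (Fin n))) :
    (randomPoset n p).real {compl '' R} = (randomPoset n p).real {R} := by
  have hinj : Function.Injective (compl : Finset (Fin n) → Finset (Fin n)) := compl_injective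
  have h : (Set.univ \ (compl '' R) : Set (Finset (Fin n))) = compl '' (Set.univ \ R) := by
    rw [Set.image_sdiff hinj, Set.image_univ_of_surjective compl_surjective]
  rw [randomPoset, ProbabilityTheory.setBernoulli_real_singleton p (Set.subset_univ _)
    (Set.toFinite _), ProbabilityTheory.setBernoulli_real_singleton p (Set.subset_univ _)
    (Set.toFinite _), h, Set.ncard_image_of_injective _ hinj, Set.ncard_image_of_injective _ hinj]

open Classical in
theorem measureReal_eq_sum {Ω : Type*} [Fintype Ω] [MeasurableSpace Ω] [MeasurableSingletonClass Ω]
    (μ : Measure Ω) [IsFiniteMeasure μ] (E : Set Ω) :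
    μ.real E = ∑ ω, if ω ∈ E then μ.real {ω} else 0 := by
  rw [← Finset.sum_filter, sum_measureReal_singleton]
  simp

/-- The law of `𝒫(n, p)` is invariant under taking complements. -/
theorem randomPoset_real_image_compl {n : ℕ} (p : unitInterval)
    (E : Set (Set (Finset (Fin n)))) :
    (randomPoset n p).real {R | compl '' R ∈ E} = (randomPoset n p).real E := by
  classical
  have hinv : Function.Involutive (fun R : Set (Finset (Fin n)) => compl '' R) := by
    intro R
    simp [Set.image_image]
  rw [measureReal_eq_sum _ E, measureReal_eq_sum]
  refine Fintype.sum_equiv hinv.toPerm _ _ fun R => ?_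
  simp only [Function.Involutive.coe_toPerm, randomPoset_real_singleton_image_compl,
    Set.mem_ofPred_eq]

/-- The weighted second moment inequality on a finite probability space. -/
theorem sq_sum_measureReal_le {Ω I : Type*} [Fintype Ω] [Fintype I] [MeasurableSpace Ω]
    [MeasurableSingletonClass Ω] (μ : Measure Ω) [IsFiniteMeasure μ] (A : I → Set Ω) (w : I → ℝ) :
    (∑ f, w f * μ.real (A f)) ^ 2 ≤
      μ.real (⋃ f, A f) * ∑ f, ∑ g, w f * w g * μ.real (A f ∩ A g) := by
  classical
  let X : Ω → ℝ := fun ω => ∑ f, if ω ∈ A f then w f else 0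
  have h1 : ∑ f, w f * μ.real (A f) = ∑ ω, μ.real {ω} * X ω := by
    simp only [measureReal_eq_sum μ (A _), X, Finset.mul_sum]
    rw [Finset.sum_comm]
    refine Finset.sum_congr rfl fun ω _ => Finset.sum_congr rfl fun f _ => ?_
    split_ifs <;> ring
  have h2 : ∑ f, ∑ g, w f * w g * μ.real (A f ∩ A g) = ∑ ω, μ.real {ω} * X ω ^ 2 := by
    have hX : ∀ ω, μ.real {ω} * X ω ^ 2 =
        ∑ f, ∑ g, w f * w g * (if ω ∈ A f ∩ A g then μ.real {ω} else 0) := fun ω => by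
      simp only [X, sq]
      rw [Finset.sum_mul_sum]
      simp only [Finset.mul_sum]
      refine Finset.sum_congr rfl fun f _ => Finset.sum_congr rfl fun g _ => ?_
      by_cases hf : ω ∈ A f <;> by_cases hg : ω ∈ A g <;> simp [hf, hg] <;> ring
    simp_rw [hX, measureReal_eq_sum μ (A _ ∩ A _), Finset.mul_sum]
    rw [Finset.sum_comm (s := Finset.univ (α := Ω))]
    refine Finset.sum_congr rfl fun f _ => Finset.sum_comm.trans ?_
    congr!
  have h3 : μ.real (⋃ f, A f) = ∑ ω, if ω ∈ ⋃ f, A f then μ.real {ω} else 0 :=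
    measureReal_eq_sum μ _
  rw [h1, h2, h3]
  -- Cauchy–Schwarz for `X` times the indicator of the union, outside of which `X` vanishes.
  refine Finset.sum_sq_le_sum_mul_sum_of_sq_le_mul _ (fun ω _ => ?_) (fun ω _ => ?_)
    fun ω _ => ?_
  · split_ifs
    exacts [measureReal_nonneg, le_rfl]
  · positivity
  · split_ifs with h
    · exact le_of_eq (by ring)
    · have : X ω = 0 := Finset.sum_eq_zero fun f _ => if_neg fun hf => h (Set.mem_iUnion.2 ⟨f, hf⟩)
      simp [this]

/-! ### Empirical distributions and the method of types -/

open Classical in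
/-- The empirical distribution of a finite sequence. -/
noncomputable def empirical {κ : Type*} {n : ℕ} (τ : Fin n → κ) (k : κ) : ℝ :=
  ((Finset.univ.filter fun i => τ i = k).card : ℝ) / n

theorem empirical_nonneg {κ : Type*} {n : ℕ} (τ : Fin n → κ) (k : κ) : 0 ≤ empirical τ k := by
  unfold empirical; positivity

theorem sum_empirical {κ : Type*} [Fintype κ] {n : ℕ} (hn : n ≠ 0) (τ : Fin n → κ) :
    ∑ k, empirical τ k = 1 := by
  classical
  have h := Finset.card_eq_sum_card_fiberwise (f := τ) (s := Finset.univ) (t := Finset.univ)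
    (by simp)
  simp only [empirical, ← Finset.sum_div]
  rw [← Nat.cast_sum, div_eq_one_iff_eq (by exact_mod_cast hn)]
  simp only [Finset.card_univ, Fintype.card_fin] at h
  exact_mod_cast h.symm

/-- The value `k` occurs `n * empirical τ k` times, so the logarithm of the product is a sum of
terms `n * p * log p`. -/
theorem prod_empirical {κ : Type*} [Fintype κ] {n : ℕ} (τ : Fin n → κ) :
    ∏ i, empirical τ (τ i) = Real.exp (-(n * entropy (empirical τ))) := by
  classical
  rcases Nat.eq_zero_or_pos n with rfl | hn
  · simp
  have hn' : (n : ℝ) ≠ 0 := by positivity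
  have hpos : ∀ i, 0 < empirical τ (τ i) := fun i => by
    unfold empirical
    have : 0 < (Finset.univ.filter fun j => τ j = τ i).card :=
      Finset.card_pos.2 ⟨i, by simp⟩
    positivity
  rw [← Real.exp_log (Finset.prod_pos fun i _ => hpos i), Real.log_prod fun i _ => (hpos i).ne']
  congr 1
  rw [← Finset.sum_fiberwise Finset.univ τ, entropy, Finset.mul_sum, ← Finset.sum_neg_distrib]
  refine Finset.sum_congr rfl fun k _ => ?_
  rw [Finset.sum_congr rfl (g := fun _ => Real.log (empirical τ k))
    (by intro i hi; rw [(Finset.mem_filter.1 hi).2]), Finset.sum_const, nsmul_eq_mul,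
    Real.negMulLog]
  have : ((Finset.univ.filter fun i => τ i = k).card : ℝ) = n * empirical τ k := by
    unfold empirical; field_simp
  rw [this]; ring

/-- A type class has at most `exp (n H)` members. -/
theorem card_empirical_eq_le {κ : Type*} [Fintype κ] {n : ℕ} (σ : Fin n → κ)
    (s : Finset (Fin n → κ)) (hs : ∀ τ ∈ s, empirical τ = empirical σ) :
    (s.card : ℝ) ≤ Real.exp (n * entropy (empirical σ)) := by
  classical
  rcases Nat.eq_zero_or_pos n with rfl | hn
  · have : s.card ≤ 1 := Finset.card_le_one_of_subsingleton s
    simpa using this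
  -- Under the i.i.d. law with distribution `empirical σ`, each member of `s` has probability `exp
  -- (-n H)`, and these probabilities sum to at most 1.
  have h1 : (s.card : ℝ) * Real.exp (-(n * entropy (empirical σ))) ≤ 1 := by
    calc (s.card : ℝ) * Real.exp (-(n * entropy (empirical σ)))
        = ∑ τ ∈ s, ∏ i, empirical σ (τ i) := by
          rw [← nsmul_eq_mul, ← Finset.sum_const]
          refine Finset.sum_congr rfl fun τ hτ => ?_
          rw [← hs τ hτ, prod_empirical]
      _ ≤ ∑ τ : Fin n → κ, ∏ i, empirical σ (τ i) :=
          Finset.sum_le_sum_of_subset_of_nonneg (Finset.subset_univ _) fun τ _ _ =>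
            Finset.prod_nonneg fun i _ => empirical_nonneg _ _
      _ = 1 := by rw [← Fintype.sum_pow, sum_empirical hn.ne', one_pow]
  rwa [Real.exp_neg, ← div_eq_mul_inv, div_le_one (Real.exp_pos _)] at h1

/-- Each of the `card κ` multiplicities lies in `{0, …, n}`, so there are at most `(n + 1) ^ card κ`
type classes, and each one that meets `s` contributes at most `exp (n h)`. -/
theorem card_entropy_le {κ : Type*} [Fintype κ] {n : ℕ} {h : ℝ} (s : Finset (Fin n → κ))
    (hs : ∀ τ ∈ s, entropy (empirical τ) ≤ h) :
    (s.card : ℝ) ≤ (n + 1 : ℝ) ^ Fintype.card κ * Real.exp (n * h) := by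
  classical
  let cnt : (Fin n → κ) → κ → Fin (n + 1) := fun τ k =>
    ⟨(Finset.univ.filter fun i => τ i = k).card,
      Nat.lt_succ_of_le ((Finset.card_le_univ _).trans_eq (Fintype.card_fin n))⟩
  have h1 := Finset.card_eq_sum_card_fiberwise (f := cnt) (s := s) (t := Finset.univ) (by simp)
  have h2 : ∀ m, ((s.filter fun τ => cnt τ = m).card : ℝ) ≤ Real.exp (n * h) := by
    intro m
    rcases (s.filter fun τ => cnt τ = m).eq_empty_or_nonempty with he | ⟨σ, hσ⟩
    · rw [he]; simp [Real.exp_nonneg]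
    · have hσ' := Finset.mem_filter.1 hσ
      refine (card_empirical_eq_le σ _ fun τ hτ => ?_).trans
        (Real.exp_le_exp.2 (mul_le_mul_of_nonneg_left (hs σ hσ'.1) (Nat.cast_nonneg _)))
      ext k
      have := congrArg (fun m : κ → Fin (n + 1) => (m k : ℕ))
        ((Finset.mem_filter.1 hτ).2.trans hσ'.2.symm)
      simp only [cnt] at this
      unfold empirical
      convert congrArg (fun x : ℕ => (x : ℝ) / n) this
  calc (s.card : ℝ) = ∑ m, ((s.filter fun τ => cnt τ = m).card : ℝ) := by exact_mod_cast h1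
    _ ≤ ∑ _m : κ → Fin (n + 1), Real.exp (n * h) := Finset.sum_le_sum fun m _ => h2 m
    _ = _ := by simp

/-! ### Order-preserving maps as sequences of antichains -/

section Shadow

variable {P : Type*} [PartialOrder P]

/-- `x` lies in the up-set generated by `S`. -/
def InUp (S : Finset P) (x : P) : Prop := ∃ y ∈ S, y ≤ x

theorem InUp.mono {S : Finset P} {x y : P} (h : InUp S x) (hxy : x ≤ y) : InUp S y :=
  let ⟨z, hz, hzx⟩ := h
  ⟨z, hz, hzx.trans hxy⟩

open Classical in
/-- The order preserving map `P → 𝒫(n)` encoded by a sequence of antichains. -/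
noncomputable def copyMap {n : ℕ} (f : Fin n → Finset P) : P →o Finset (Fin n) where
  toFun x := Finset.univ.filter fun i => InUp (f i) x
  monotone' x y hxy i hi := by
    simp only [Finset.mem_filter, Finset.mem_univ, true_and] at hi ⊢
    exact hi.mono hxy

@[simp]
theorem mem_copyMap {n : ℕ} {f : Fin n → Finset P} {x : P} {i : Fin n} :
    i ∈ copyMap f x ↔ InUp (f i) x := by
  classical
  exact Finset.mem_filter.trans (by simp)

variable [Fintype P]

theorem mem_shadow {Q S : Finset P} {y : P} :
    y ∈ shadow Q S ↔ y ∈ Q ∧ InUp S y ∧ ∀ z ∈ Q, z < y → ¬ InUp S z := by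
  simp [shadow, InUp]

theorem shadow_mem_antichains (Q S : Finset P) : shadow Q S ∈ antichains Q := by
  classical
  simp only [antichains, Finset.mem_filter, Finset.mem_powerset]
  refine ⟨fun y hy => (mem_shadow.1 hy).1, fun x hx y hy hne hle => ?_⟩
  exact (mem_shadow.1 hy).2.2 x (mem_shadow.1 hx).1 (lt_of_le_of_ne hle hne) (mem_shadow.1 hx).2.1

/-- By finiteness every element of `Q` in the up-set of `S` lies above a minimal such element. Thus
a shadow in `Q` carries exactly the trace on `Q` of the generated up-set. -/
theorem inUp_shadow {Q S : Finset P} {x : P} (hx : x ∈ Q) :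
    InUp (shadow Q S) x ↔ InUp S x := by
  classical
  constructor
  · rintro ⟨y, hy, hyx⟩
    exact (mem_shadow.1 hy).2.1.mono hyx
  · intro h
    obtain ⟨m, hmx, hm⟩ := (Q.filter fun z => InUp S z).exists_le_minimal
      (Finset.mem_filter.2 ⟨hx, h⟩)
    have hmem := Finset.mem_filter.1 hm.1
    refine ⟨m, mem_shadow.2 ⟨hmem.1, hmem.2, fun z hz hzm hup => ?_⟩, hmx⟩
    exact absurd (hm.2 (Finset.mem_filter.2 ⟨hz, hup⟩) hzm.le) (not_le_of_gt hzm)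

theorem shadow_congr {Q S S' : Finset P} (h : ∀ x ∈ Q, InUp S x ↔ InUp S' x) :
    shadow Q S = shadow Q S' := by
  ext y
  rw [mem_shadow, mem_shadow]
  constructor
  · rintro ⟨h1, h2, h3⟩
    exact ⟨h1, (h y h1).1 h2, fun z hz hzy hup => h3 z hz hzy ((h z hz).2 hup)⟩
  · rintro ⟨h1, h2, h3⟩
    exact ⟨h1, (h y h1).2 h2, fun z hz hzy hup => h3 z hz hzy ((h z hz).1 hup)⟩

theorem shadow_eq_iff {Q S S' : Finset P} :
    shadow Q S = shadow Q S' ↔ ∀ x ∈ Q, InUp S x ↔ InUp S' x :=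
  ⟨fun h x hx => by rw [← inUp_shadow hx, h, inUp_shadow hx], shadow_congr⟩

/-- The shadow in `Q`, as a map between types of antichains. -/
noncomputable def shadowIn (Q : Finset P) (S : antichains (Finset.univ : Finset P)) :
    antichains Q :=
  ⟨shadow Q S, shadow_mem_antichains Q S⟩

theorem shadowIn_eq_iff {Q : Finset P} {S S' : antichains (Finset.univ : Finset P)} :
    shadowIn Q S = shadowIn Q S' ↔ ∀ x ∈ Q, InUp (S : Finset P) x ↔ InUp (S' : Finset P) x := by
  simp only [shadowIn, Subtype.mk.injEq, shadow_eq_iff]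

open Classical in
theorem inducedWeighting_eq (Q : Finset P) (α : antichains (Finset.univ : Finset P) → ℝ)
    (T : antichains Q) :
    inducedWeighting Q α T = ∑ S, if shadowIn Q S = T then α S else 0 := by
  unfold inducedWeighting
  refine Finset.sum_congr rfl fun S _ => ?_
  simp only [shadowIn, Subtype.ext_iff]

-- Monotonicity of `φ` makes `{x | i ∈ φ x}` an up-set, which its minimal elements generate.
open Classical in
theorem exists_copyMap_eq {n : ℕ} (φ : P →o Finset (Fin n)) :
    ∃ f : Fin n → antichains (Finset.univ : Finset P), copyMap (fun i => (f i : Finset P)) = φ := by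
  refine ⟨fun i => ⟨shadow Finset.univ (Finset.univ.filter fun x => i ∈ φ x),
    shadow_mem_antichains _ _⟩, ?_⟩
  ext x i
  simp only [mem_copyMap, inUp_shadow (Finset.mem_univ x)]
  constructor
  · rintro ⟨y, hy, hyx⟩
    exact φ.monotone hyx (Finset.mem_filter.1 hy).2
  · exact fun h => ⟨x, by simpa using h, le_rfl⟩

theorem copyMap_shadowIn {n : ℕ} {Q : Finset P}
    (f : Fin n → antichains (Finset.univ : Finset P)) {x : P} (hx : x ∈ Q) :
    copyMap (fun i => (shadowIn Q (f i) : Finset P)) x =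
      copyMap (fun i => (f i : Finset P)) x := by
  ext i
  simp only [mem_copyMap, shadowIn, inUp_shadow hx]

/-- This identifies the entropies in the definition of `c_⋆` with those that count restrictions of a
map to `Q`. -/
theorem inducedWeighting_empirical {n : ℕ} (Q : Finset P)
    (f : Fin n → antichains (Finset.univ : Finset P)) :
    inducedWeighting Q (empirical f) = empirical fun i => shadowIn Q (f i) := by
  classical
  ext T
  rw [inducedWeighting_eq, ← Finset.sum_filter]
  unfold empirical
  rw [← Finset.sum_div, ← Nat.cast_sum]
  congr 2
  have h := Finset.card_eq_sum_card_fiberwise (f := f)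
    (s := Finset.univ.filter fun i => shadowIn Q (f i) = T)
    (t := Finset.univ.filter fun S => shadowIn Q S = T) (fun i hi => by simpa using hi)
  have h' : ∑ S ∈ Finset.univ.filter (fun S => shadowIn Q S = T),
      (Finset.univ.filter fun i => f i = S).card =
      (Finset.univ.filter fun i => shadowIn Q (f i) = T).card := by
    refine Eq.trans (Finset.sum_congr rfl fun S hS => ?_) h.symm
    congr 1
    ext i
    simp only [Finset.mem_filter, Finset.mem_univ, true_and] at hS ⊢
    exact ⟨fun h => ⟨h ▸ hS, h⟩, fun h => h.2⟩
  convert h'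

end Shadow

/-! ### Events that hold with high probability -/

theorem tendsto_succ_pow_mul_exp_neg (k : ℕ) {δ : ℝ} (hδ : 0 < δ) :
    Tendsto (fun n : ℕ => (n + 1 : ℝ) ^ k * Real.exp (-δ * n)) atTop (𝓝 0) := by
  have h := tendsto_pow_const_mul_const_pow_of_abs_lt_one k (r := Real.exp (-δ))
    (by rw [abs_of_pos (Real.exp_pos _), Real.exp_lt_one_iff]; linarith)
  have h2 := ((tendsto_add_atTop_iff_nat 1).2 h).mul_const (Real.exp δ)
  rw [zero_mul] at h2
  refine h2.congr fun n => ?_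
  rw [← Real.exp_nat_mul, mul_assoc, ← Real.exp_add]
  push_cast
  congr 2
  ring

/-- A property whose failure has probability tending to `0` holds with high probability. -/
theorem holdsWhp_of_compl_le {c : ℝ} {hc : 0 < c} {E : ∀ n : ℕ, Set (Set (Finset (Fin n)))}
    {b : ℕ → ℝ} (hb : Tendsto b atTop (𝓝 0))
    (h : ∀ᶠ n in atTop, (randomPoset n (retainProb c hc n)).real (E n)ᶜ ≤ b n) :
    HoldsWhp c hc E := by
  have h1 : Tendsto (fun n => 1 - b n) atTop (𝓝 1) := by
    simpa using tendsto_const_nhds.sub hb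
  refine tendsto_of_tendsto_of_tendsto_of_le_of_le' h1 tendsto_const_nhds ?_
    (Eventually.of_forall fun n => measureReal_le_one)
  filter_upwards [h] with n hn
  rw [measureReal_compl (by exact MeasurableSet.of_discrete), probReal_univ] at hn
  linarith

theorem HoldsWhp.mono {c : ℝ} {hc : 0 < c} {E F : ∀ n : ℕ, Set (Set (Finset (Fin n)))}
    (h : HoldsWhp c hc E) (hEF : ∀ n, E n ⊆ F n) : HoldsWhp c hc F :=
  tendsto_of_tendsto_of_tendsto_of_le_of_le h tendsto_const_nhds
    (fun n => measureReal_mono (hEF n)) fun n => measureReal_le_one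

theorem HoldsWhp.inter {c : ℝ} {hc : 0 < c} {E F : ∀ n : ℕ, Set (Set (Finset (Fin n)))}
    (hE : HoldsWhp c hc E) (hF : HoldsWhp c hc F) : HoldsWhp c hc fun n => E n ∩ F n := by
  have h : Tendsto (fun n => (1 - (randomPoset n (retainProb c hc n)).real (E n)) +
      (1 - (randomPoset n (retainProb c hc n)).real (F n))) atTop (𝓝 0) := by
    simpa using ((tendsto_const_nhds (x := (1 : ℝ))).sub hE).add
      ((tendsto_const_nhds (x := (1 : ℝ))).sub hF)
  refine holdsWhp_of_compl_le h (Eventually.of_forall fun n => ?_)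
  rw [Set.compl_inter]
  refine (measureReal_union_le _ _).trans_eq ?_
  rw [measureReal_compl (by exact MeasurableSet.of_discrete),
    measureReal_compl (by exact MeasurableSet.of_discrete), probReal_univ]

theorem retainProb_pow (c : ℝ) (hc : 0 < c) (n k : ℕ) :
    (retainProb c hc n : ℝ) ^ k = Real.exp (-(c * k) * n) := by
  simp only [retainProb]
  rw [← Real.exp_nat_mul]
  congr 1
  ring

/-! ### No copy above the critical exponent -/

/-- The image of `P` under some injective order preserving map lies in `R`. -/
def HasCopy (P : Type*) [PartialOrder P] {n : ℕ} (R : Set (Finset (Fin n))) : Prop :=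
  ∃ φ : P →o Finset (Fin n), Function.Injective φ ∧ ∀ x, φ x ∈ R

/-- Above the critical exponent there is no copy with high probability. -/
theorem holdsWhp_not_hasCopy (P : Type*) [PartialOrder P] [Fintype P] {c : ℝ} (hc : 0 < c)
    (h : criticalExponent P < c) (hbdd : BddAbove (admissibleExponents P)) :
    HoldsWhp c hc fun _ => {R | ¬ HasCopy P R} := by
  classical
  -- The gap `c - c'` absorbs the polynomial number of types. The maximum with 0 keeps `c'` in the
  -- range where admissibility is defined.
  obtain ⟨c', hc', hc'c⟩ := exists_between (max_lt h hc)
  have hlow : criticalExponent P < c' := (le_max_left _ _).trans_lt hc'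
  have hc'0 : 0 < c' := (le_max_right _ _).trans_lt hc'
  let s : Finset (Finset P) := Finset.univ.filter Finset.Nonempty
  let b : ℕ → ℝ := fun n => ∑ Q ∈ s,
    (n + 1 : ℝ) ^ Fintype.card (antichains Q) * Real.exp (-((c - c') * Q.card) * n)
  have hb : Tendsto b atTop (𝓝 0) := by
    rw [← Finset.sum_const_zero (s := s)]
    refine tendsto_finsetSum _ fun Q hQ => tendsto_succ_pow_mul_exp_neg _ ?_
    have : 0 < Q.card := Finset.card_pos.2 (Finset.mem_filter.1 hQ).2
    have h2 : 0 < c - c' := sub_pos.2 hc'c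
    positivity
  refine holdsWhp_of_compl_le hb ?_
  filter_upwards [eventually_ge_atTop 1] with n hn
  -- Low-entropy encodings of maps on `Q` alone. Injectivity on `Q` gives the image `Q.card`
  -- elements, hence probability `exp (-c n Q.card)` of being present.
  let T : ∀ Q : Finset P, Finset (Fin n → antichains Q) := fun Q => Finset.univ.filter fun τ =>
    entropy (empirical τ) ≤ c' * Q.card ∧ Set.InjOn (copyMap fun i => (τ i : Finset P)) Q
  let A : ∀ Q : Finset P, (Fin n → antichains Q) → Set (Set (Finset (Fin n))) := fun Q τ =>
    {R | ((Q.image (copyMap fun i => (τ i : Finset P)) : Finset _) : Set (Finset (Fin n))) ⊆ R}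
  have hsub : {R | ¬ HasCopy P R}ᶜ ⊆ ⋃ Q ∈ s, ⋃ τ ∈ T Q, A Q τ := by
    intro R hR
    simp only [Set.mem_compl_iff, Set.mem_ofPred_eq, not_not] at hR
    obtain ⟨φ, hinj, hmem⟩ := hR
    obtain ⟨f, rfl⟩ := exists_copyMap_eq φ
    have hmemsimp : empirical f ∈ stdSimplex ℝ (antichains (Finset.univ : Finset P)) :=
      ⟨empirical_nonneg f, sum_empirical (by omega) f⟩
    -- Otherwise the empirical weighting itself would witness that `c' > c_⋆(P)` is admissible.
    have hex : ∃ Q : Finset P, Q.Nonempty ∧ criticalExponentIn (empirical f) Q < c' := by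
      by_contra! hcon
      exact absurd (le_csSup hbdd ⟨hc'0.le, _, hmemsimp, hcon⟩) (not_le_of_gt hlow)
    obtain ⟨Q, hQ, hlt⟩ := hex
    have hcard : (0 : ℝ) < Q.card := by exact_mod_cast Finset.card_pos.2 hQ
    rw [criticalExponentIn, div_lt_iff₀ hcard, inducedWeighting_empirical] at hlt
    simp only [Set.mem_iUnion]
    refine ⟨Q, by simpa [s] using hQ, fun i => shadowIn Q (f i), ?_, ?_⟩
    · refine Finset.mem_filter.2 ⟨Finset.mem_univ _, hlt.le, fun x hx y hy hxy => hinj ?_⟩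
      simpa only [copyMap_shadowIn f hx, copyMap_shadowIn f hy] using hxy
    · intro z hz
      obtain ⟨x, hx, rfl⟩ := Finset.mem_image.1 (Finset.mem_coe.1 hz)
      rw [copyMap_shadowIn f hx]
      exact hmem x
  refine (measureReal_mono hsub (measure_ne_top _ _)).trans ((measureReal_biUnion_finset_le _ _).trans ?_)
  refine Finset.sum_le_sum fun Q hQ => (measureReal_biUnion_finset_le _ _).trans ?_
  have hA : ∀ τ ∈ T Q, (randomPoset n (retainProb c hc n)).real (A Q τ) =
      Real.exp (-(c * Q.card) * n) := fun τ hτ => by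
    rw [randomPoset_real_superset, Finset.card_image_of_injOn (Finset.mem_filter.1 hτ).2.2,
      retainProb_pow]
  rw [Finset.sum_congr rfl hA, Finset.sum_const, nsmul_eq_mul]
  have hT := card_entropy_le (T Q) (h := c' * Q.card) fun τ hτ => (Finset.mem_filter.1 hτ).2.1
  refine (mul_le_mul_of_nonneg_right hT (Real.exp_nonneg _)).trans_eq ?_
  rw [mul_assoc, ← Real.exp_add]
  congr 2
  ring

/-! ### Product weightings and exponential tail bounds -/

section ProductWeight

variable {ι κ : Type*} [Fintype ι]

open Classical in
/-- The push-forward of a weighting. -/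
noncomputable def pushWeight (γ : ι → κ) (α : ι → ℝ) (k : κ) : ℝ :=
  ∑ S, if γ S = k then α S else 0

theorem pushWeight_nonneg {γ : ι → κ} {α : ι → ℝ} (hα : ∀ S, 0 ≤ α S) (k : κ) :
    0 ≤ pushWeight γ α k :=
  Finset.sum_nonneg fun S _ => by split_ifs; exacts [hα S, le_rfl]

theorem le_pushWeight {γ : ι → κ} {α : ι → ℝ} (hα : ∀ S, 0 ≤ α S) (S : ι) :
    α S ≤ pushWeight γ α (γ S) := by
  classical
  unfold pushWeight
  refine le_trans ?_ (Finset.single_le_sum (a := S) (fun S' _ => ?_) (Finset.mem_univ _))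
  · simp
  · split_ifs; exacts [hα S', le_rfl]

theorem sum_pushWeight_mul [Fintype κ] (γ : ι → κ) (α : ι → ℝ) (u : κ → ℝ) :
    ∑ k, pushWeight γ α k * u k = ∑ S, α S * u (γ S) := by
  classical
  simp only [pushWeight, Finset.sum_mul]
  rw [Finset.sum_comm]
  refine Finset.sum_congr rfl fun S _ => ?_
  simp [ite_mul]

-- Expanding the product of fibre sums gives one term for each choice of a preimage at each
-- coordinate.
open Classical in
theorem sum_prod_fiber {n : ℕ} (γ : ι → κ) (α : ι → ℝ) (τ : Fin n → κ) :
    ∑ g : Fin n → ι, (if ∀ i, γ (g i) = τ i then ∏ i, α (g i) else 0) =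
      ∏ i, pushWeight γ α (τ i) := by
  simp only [pushWeight]
  rw [Finset.prod_univ_sum]
  simp only [Fintype.piFinset_univ]
  refine Finset.sum_congr rfl fun g _ => ?_
  rw [Finset.prod_ite_zero]
  simp

open Classical in
/-- Exponential decay of the probability that an i.i.d. sequence is atypically likely. -/
theorem exists_sum_atypical_le [Fintype κ] {γ : ι → κ} {α : ι → ℝ} (hα : α ∈ stdSimplex ℝ ι) {ε : ℝ}
    (hε : 0 < ε) : ∃ ρ : ℝ, 0 ≤ ρ ∧ ρ < 1 ∧ ∀ n : ℕ,
      ∑ f : Fin n → ι, (if Real.exp (-(n * (entropy (pushWeight γ α) - ε))) <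
        ∏ i, pushWeight γ α (γ (f i)) then ∏ i, α (f i) else 0) ≤ ρ ^ n := by
  set β := pushWeight γ α with hβ
  set H := entropy β with hH
  let u : ι → ℝ := fun S => Real.log (β (γ S)) + (H - ε)
  let G : ℝ → ℝ := fun t => ∑ S, α S * Real.exp (t * u S)
  have hG0 : G 0 = 1 := by simp [G, hα.2]
  -- Chernoff's method: `G` is the moment generating function of `u`, whose mean is `-ε`. Hence `G`
  -- drops below `G 0 = 1` at some `t > 0`, while an atypical sequence has `∑ u > 0`.
  have hderiv : HasDerivAt G (∑ S, α S * (Real.exp (0 * u S) * (1 * u S))) 0 :=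
    HasDerivAt.fun_sum fun S _ => (((hasDerivAt_id (0 : ℝ)).mul_const (u S)).exp).const_mul (α S)
  have hval : ∑ S, α S * (Real.exp (0 * u S) * (1 * u S)) = -ε := by
    have h1 : ∑ S, α S * Real.log (β (γ S)) = -H := by
      rw [hβ, ← sum_pushWeight_mul γ α fun k => Real.log (pushWeight γ α k), hH, entropy,
        ← Finset.sum_neg_distrib]
      refine Finset.sum_congr rfl fun k _ => ?_
      simp [Real.negMulLog, hβ]
    simp only [zero_mul, Real.exp_zero, one_mul]
    simp only [u, mul_add, Finset.sum_add_distrib, h1,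
      ← Finset.sum_mul, hα.2]
    ring
  rw [hval] at hderiv
  obtain ⟨t, ht, hGt⟩ : ∃ t : ℝ, 0 < t ∧ G t < 1 := by
    have h1 := hasDerivAt_iff_tendsto_slope.1 hderiv
    have h2 := (h1.mono_left (nhdsWithin_mono 0 (s := Set.Ioi 0) fun t ht => ne_of_gt ht)).eventually
      (gt_mem_nhds (neg_lt_zero.2 hε))
    obtain ⟨t, hlt, ht⟩ := (h2.and self_mem_nhdsWithin).exists
    refine ⟨t, ht, ?_⟩
    rw [slope_def_field, hG0, sub_zero] at hlt
    have := (div_neg_iff.1 hlt).resolve_left fun h => absurd h.2 (not_lt_of_gt ht)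
    linarith [this.1]
  refine ⟨G t, Finset.sum_nonneg fun S _ => mul_nonneg (hα.1 S) (Real.exp_nonneg _), hGt,
    fun n => ?_⟩
  simp only [G]
  rw [Fintype.sum_pow]
  refine Finset.sum_le_sum fun f _ => ?_
  have hnn : 0 ≤ ∏ i, α (f i) := Finset.prod_nonneg fun i _ => hα.1 _
  split_ifs with hbad
  · rw [Finset.prod_mul_distrib]
    refine le_mul_of_one_le_right hnn ?_
    rw [← Real.exp_sum, Real.one_le_exp_iff, ← Finset.mul_sum]
    refine mul_nonneg ht.le ?_
    simp only [u, Finset.sum_add_distrib, Finset.sum_const, Finset.card_univ, Fintype.card_fin,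
      nsmul_eq_mul]
    have hpos : 0 < ∏ i, β (γ (f i)) := (Real.exp_pos _).trans hbad
    have hne : ∀ i ∈ Finset.univ, β (γ (f i)) ≠ 0 := Finset.prod_ne_zero_iff.1 hpos.ne'
    rw [← Real.log_prod hne]
    have := (Real.lt_log_iff_exp_lt hpos).2 hbad
    linarith
  · exact Finset.prod_nonneg fun i _ => mul_nonneg (hα.1 _) (Real.exp_nonneg _)

end ProductWeight

theorem inducedWeighting_eq_pushWeight {P : Type*} [Fintype P] [PartialOrder P] (Q : Finset P)
    (α : antichains (Finset.univ : Finset P) → ℝ) :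
    inducedWeighting Q α = pushWeight (shadowIn Q) α := by
  ext T
  rw [inducedWeighting_eq, pushWeight]
  congr!

open Classical in
/-- The total weight of the sequences whose map does not separate `x` and `y` decays. -/
theorem exists_sum_not_separating_le {P : Type*} [Fintype P] [PartialOrder P]
    {α : antichains (Finset.univ : Finset P) → ℝ} (hα : α ∈ stdSimplex ℝ _) (hpos : ∀ S, 0 < α S)
    {x y : P} (hxy : x ≠ y) : ∃ ρ : ℝ, 0 ≤ ρ ∧ ρ < 1 ∧ ∀ n : ℕ,
      ∑ f : Fin n → antichains (Finset.univ : Finset P),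
        (if copyMap (fun i => (f i : Finset P)) x = copyMap (fun i => (f i : Finset P)) y
          then ∏ i, α (f i) else 0) ≤ ρ ^ n := by
  let p : antichains (Finset.univ : Finset P) → Prop := fun S =>
    InUp (S : Finset P) x ↔ InUp (S : Finset P) y
  refine ⟨∑ S, if p S then α S else 0, Finset.sum_nonneg fun S _ => ?_, ?_, fun n => ?_⟩
  · split_ifs; exacts [(hpos S).le, le_rfl]
  · have hsing : ∀ z : P, ({z} : Finset P) ∈ antichains (Finset.univ : Finset P) := fun z => by
      simp [antichains]
    -- A singleton at one of the two points generates an up-set missing the other. Full support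
    -- gives it positive weight, so the non-separating mass is below 1.
    obtain ⟨S, hS⟩ : ∃ S, ¬ p S := by
      by_cases h : x ≤ y
      · refine ⟨⟨{y}, hsing y⟩, fun hp => ?_⟩
        have h2 : y ≤ x := by simpa [p, InUp] using hp
        exact hxy (le_antisymm h h2)
      · exact ⟨⟨{x}, hsing x⟩, fun hp => h (by simpa [p, InUp] using hp)⟩
    rw [← hα.2]
    refine Finset.sum_lt_sum (fun S' _ => ?_) ⟨S, Finset.mem_univ _, ?_⟩
    · split_ifs; exacts [le_rfl, (hpos S').le]
    · rw [if_neg hS]; exact hpos S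
  · rw [Fintype.sum_pow]
    refine Finset.sum_le_sum fun f _ => ?_
    rw [Finset.prod_ite_zero]
    have hiff : copyMap (fun i => (f i : Finset P)) x = copyMap (fun i => (f i : Finset P)) y ↔
        ∀ i ∈ Finset.univ, p (f i) := by simp [Finset.ext_iff, p]
    split_ifs with h1 h2 h2
    exacts [le_rfl, absurd (hiff.1 h1) h2, absurd (hiff.2 h2) h1, le_rfl]

/-- Perturbing a weighting so that it has full support. -/
theorem exists_pos_weighting {P : Type*} [Fintype P] [PartialOrder P]
    {α : antichains (Finset.univ : Finset P) → ℝ} (hα : α ∈ stdSimplex ℝ _) {c c' : ℝ}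
    (hcc' : c < c')
    (hQ : ∀ Q : Finset P, Q.Nonempty → c' ≤ criticalExponentIn α Q) :
    ∃ α' ∈ stdSimplex ℝ (antichains (Finset.univ : Finset P)), (∀ S, 0 < α' S) ∧
      ∀ Q : Finset P, Q.Nonempty → c ≤ criticalExponentIn α' Q := by
  classical
  let N : ℝ := Fintype.card (antichains (Finset.univ : Finset P))
  have h0 : (∅ : Finset P) ∈ antichains (Finset.univ : Finset P) := by simp [antichains]
  have hN : 0 < N := Nat.cast_pos.2 (Fintype.card_pos_iff.2 ⟨⟨∅, h0⟩⟩)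
  -- Mixing with the uniform weighting gives full support; since the exponents are continuous in `t`
  -- and there are finitely many `Q`, a small `t` costs less than `c' - c`.
  let a : ℝ → antichains (Finset.univ : Finset P) → ℝ := fun t S => (1 - t) * α S + t * N⁻¹
  have hcont : ∀ Q, Continuous fun t => criticalExponentIn (a t) Q := fun Q => by
    unfold criticalExponentIn entropy
    simp only [inducedWeighting_eq]
    refine (continuous_finsetSum _ fun T _ => Real.continuous_negMulLog.comp
      (continuous_finsetSum _ fun S _ => ?_)).div_const _
    split_ifs
    · fun_prop
    · fun_prop
  have ha0 : a 0 = α := by ext S; simp [a]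
  have hev : ∀ᶠ t in 𝓝[>] (0 : ℝ), ∀ Q : Finset P, Q.Nonempty → c < criticalExponentIn (a t) Q := by
    refine eventually_all.2 fun Q => ?_
    by_cases hne : Q.Nonempty
    · have h1 := (hcont Q).tendsto 0
      rw [ha0] at h1
      filter_upwards [(h1.mono_left nhdsWithin_le_nhds).eventually
        (lt_mem_nhds (hcc'.trans_le (hQ Q hne)))] with t ht _ using ht
    · exact Eventually.of_forall fun t h => absurd h hne
  obtain ⟨t, ht, htI⟩ := (hev.and (Ioo_mem_nhdsGT (zero_lt_one (α := ℝ)))).exists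
  have hpos : ∀ S, 0 < a t S := fun S =>
    add_pos_of_nonneg_of_pos (mul_nonneg (by linarith [htI.2]) (hα.1 S))
      (mul_pos htI.1 (inv_pos.2 hN))
  refine ⟨a t, ⟨fun S => (hpos S).le, ?_⟩, hpos, fun Q hne => (ht Q hne).le⟩
  simp only [a, Finset.sum_add_distrib, ← Finset.mul_sum, hα.2, Finset.sum_const, Finset.card_univ,
    nsmul_eq_mul]
  change (1 - t) * 1 + t * (N * N⁻¹) = 1
  rw [mul_inv_cancel₀ hN.ne']
  ring

/-! ### A copy below the critical exponent: the weighted second moment -/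

section SecondMoment

variable {P : Type*} [Fintype P] [PartialOrder P]

/-- The map encoded by `f` is injective and none of its restrictions is atypically likely under the
product weighting `α ^ n`. -/
def IsTypical (α : antichains (Finset.univ : Finset P) → ℝ) (ε : ℝ) {n : ℕ}
    (f : Fin n → antichains (Finset.univ : Finset P)) : Prop :=
  Function.Injective (copyMap fun i => (f i : Finset P)) ∧ ∀ Q : Finset P, Q.Nonempty →
    ∏ i, inducedWeighting Q α (shadowIn Q (f i)) ≤
      Real.exp (-(n * (entropy (inducedWeighting Q α) - ε)))

open Classical in
/-- The product weighting restricted to the typical sequences. -/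
noncomputable def typicalWeight (α : antichains (Finset.univ : Finset P) → ℝ) (ε : ℝ) {n : ℕ}
    (f : Fin n → antichains (Finset.univ : Finset P)) : ℝ :=
  if IsTypical α ε f then ∏ i, α (f i) else 0

theorem typicalWeight_nonneg {α : antichains (Finset.univ : Finset P) → ℝ} (hα : ∀ S, 0 ≤ α S)
    (ε : ℝ) {n : ℕ} (f : Fin n → antichains (Finset.univ : Finset P)) :
    0 ≤ typicalWeight α ε f := by
  unfold typicalWeight
  split_ifs
  exacts [Finset.prod_nonneg fun i _ => hα _, le_rfl]

theorem sum_typicalWeight_le_one {α : antichains (Finset.univ : Finset P) → ℝ}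
    (hα : α ∈ stdSimplex ℝ _) (ε : ℝ) (n : ℕ) :
    ∑ f : Fin n → antichains (Finset.univ : Finset P), typicalWeight α ε f ≤ 1 := by
  calc _ ≤ ∑ f : Fin n → antichains (Finset.univ : Finset P), ∏ i, α (f i) := by
        refine Finset.sum_le_sum fun f _ => ?_
        unfold typicalWeight
        split_ifs
        exacts [le_rfl, Finset.prod_nonneg fun i _ => hα.1 _]
    _ = 1 := by rw [← Fintype.sum_pow, hα.2, one_pow]

/-- Typicality can fail only through one of finitely many pairs `x ≠ y` not being separated, or one
of finitely many `Q` being atypically likely; each failure has exponentially small mass. -/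
theorem tendsto_sum_typicalWeight {α : antichains (Finset.univ : Finset P) → ℝ}
    (hα : α ∈ stdSimplex ℝ _) (hpos : ∀ S, 0 < α S) {ε : ℝ} (hε : 0 < ε) :
    Tendsto (fun n : ℕ => ∑ f : Fin n → antichains (Finset.univ : Finset P), typicalWeight α ε f)
      atTop (𝓝 1) := by
  classical
  have hQ : ∀ Q : Finset P, ∃ ρ : ℝ, 0 ≤ ρ ∧ ρ < 1 ∧ ∀ n : ℕ,
      ∑ f : Fin n → antichains (Finset.univ : Finset P),
        (if Real.exp (-(n * (entropy (inducedWeighting Q α) - ε))) <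
          ∏ i, inducedWeighting Q α (shadowIn Q (f i)) then ∏ i, α (f i) else 0) ≤ ρ ^ n := by
    intro Q
    obtain ⟨ρ, h0, h1, h⟩ := exists_sum_atypical_le (γ := shadowIn Q) hα hε
    refine ⟨ρ, h0, h1, fun n => ?_⟩
    rw [inducedWeighting_eq_pushWeight]
    convert h n
  choose ρ hρ0 hρ1 hρ using hQ
  have hxy : ∀ z : P × P, ∃ ρ : ℝ, 0 ≤ ρ ∧ ρ < 1 ∧ (z.1 ≠ z.2 → ∀ n : ℕ,
      ∑ f : Fin n → antichains (Finset.univ : Finset P),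
        (if copyMap (fun i => (f i : Finset P)) z.1 = copyMap (fun i => (f i : Finset P)) z.2
          then ∏ i, α (f i) else 0) ≤ ρ ^ n) := by
    rintro ⟨x, y⟩
    by_cases h : x = y
    · exact ⟨0, le_rfl, zero_lt_one, fun hne => absurd h hne⟩
    · obtain ⟨ρ, h0, h1, h2⟩ := exists_sum_not_separating_le hα hpos h
      refine ⟨ρ, h0, h1, fun _ n => ?_⟩
      convert h2 n
  choose σ hσ0 hσ1 hσ using hxy
  have hlim : Tendsto (fun n : ℕ => 1 - (∑ Q, ρ Q ^ n + ∑ z, σ z ^ n)) atTop (𝓝 1) := by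
    have h1 : Tendsto (fun n : ℕ => ∑ Q, ρ Q ^ n) atTop (𝓝 (∑ _Q : Finset P, (0 : ℝ))) :=
      tendsto_finsetSum _ fun Q _ => tendsto_pow_atTop_nhds_zero_of_lt_one (hρ0 Q) (hρ1 Q)
    have h2 : Tendsto (fun n : ℕ => ∑ z, σ z ^ n) atTop (𝓝 (∑ _z : P × P, (0 : ℝ))) :=
      tendsto_finsetSum _ fun z _ => tendsto_pow_atTop_nhds_zero_of_lt_one (hσ0 z) (hσ1 z)
    simpa using (tendsto_const_nhds (x := (1 : ℝ))).sub (h1.add h2)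
  refine tendsto_of_tendsto_of_tendsto_of_le_of_le hlim tendsto_const_nhds (fun n => ?_)
    fun n => sum_typicalWeight_le_one hα ε n
  have hsum : ∑ f : Fin n → antichains (Finset.univ : Finset P), ∏ i, α (f i) = 1 := by
    rw [← Fintype.sum_pow, hα.2, one_pow]
  have hnn : ∀ f : Fin n → antichains (Finset.univ : Finset P), 0 ≤ ∏ i, α (f i) :=
    fun f => Finset.prod_nonneg fun i _ => hα.1 _
  have key : ∀ f : Fin n → antichains (Finset.univ : Finset P), ∏ i, α (f i) ≤
      typicalWeight α ε f +
      (∑ Q, (if Real.exp (-(n * (entropy (inducedWeighting Q α) - ε))) <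
          ∏ i, inducedWeighting Q α (shadowIn Q (f i)) then ∏ i, α (f i) else 0) +
      ∑ z : P × P, if z.1 ≠ z.2 then
        (if copyMap (fun i => (f i : Finset P)) z.1 = copyMap (fun i => (f i : Finset P)) z.2
          then ∏ i, α (f i) else 0) else 0) := by
    intro f
    have hA : ∀ Q : Finset P, 0 ≤ (if Real.exp (-(n * (entropy (inducedWeighting Q α) - ε))) <
          ∏ i, inducedWeighting Q α (shadowIn Q (f i)) then ∏ i, α (f i) else 0) := fun Q => by
      split_ifs; exacts [hnn f, le_rfl]
    have hB : ∀ z : P × P, 0 ≤ if z.1 ≠ z.2 then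
        (if copyMap (fun i => (f i : Finset P)) z.1 = copyMap (fun i => (f i : Finset P)) z.2
          then ∏ i, α (f i) else 0) else 0 := fun z => by
      split_ifs; exacts [hnn f, le_rfl, le_rfl]
    have hA' := Finset.sum_nonneg fun Q (_ : Q ∈ Finset.univ) => hA Q
    have hB' := Finset.sum_nonneg fun z (_ : z ∈ Finset.univ) => hB z
    by_cases hT : IsTypical α ε f
    · rw [typicalWeight, if_pos hT]
      linarith
    · have h0 := typicalWeight_nonneg hα.1 ε f
      rw [IsTypical, not_and_or] at hT
      rcases hT with hT | hT
      · simp only [Function.Injective, not_forall] at hT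
        obtain ⟨x, y, hxy, hne⟩ := hT
        have := Finset.single_le_sum (fun z _ => hB z) (Finset.mem_univ (x, y))
        rw [if_pos hne, if_pos hxy] at this
        linarith
      · push Not at hT
        obtain ⟨Q, -, hlt⟩ := hT
        have := Finset.single_le_sum (fun z _ => hA z) (Finset.mem_univ Q)
        rw [if_pos hlt] at this
        linarith
  have h1 := Finset.sum_le_sum fun f (_ : f ∈ Finset.univ) => key f
  rw [hsum, Finset.sum_add_distrib, Finset.sum_add_distrib, Finset.sum_comm,
    Finset.sum_comm (t := (Finset.univ : Finset (P × P)))] at h1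
  have h2 : ∑ Q : Finset P, ∑ f : Fin n → antichains (Finset.univ : Finset P),
      (if Real.exp (-(n * (entropy (inducedWeighting Q α) - ε))) <
          ∏ i, inducedWeighting Q α (shadowIn Q (f i)) then ∏ i, α (f i) else 0) ≤
      ∑ Q, ρ Q ^ n := Finset.sum_le_sum fun Q _ => hρ Q n
  have h3 : ∑ z : P × P, ∑ f : Fin n → antichains (Finset.univ : Finset P),
      (if z.1 ≠ z.2 then
        (if copyMap (fun i => (f i : Finset P)) z.1 = copyMap (fun i => (f i : Finset P)) z.2
          then ∏ i, α (f i) else 0) else 0) ≤ ∑ z, σ z ^ n :=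
    Finset.sum_le_sum fun z _ => by
      split_ifs with h
      · exact hσ z h n
      · rw [Finset.sum_const_zero]; exact pow_nonneg (hσ0 z) n
  linarith

open Classical in
/-- A prescribed restriction has small probability among typical sequences. -/
theorem sum_typicalWeight_fiber_le {α : antichains (Finset.univ : Finset P) → ℝ}
    (hα : ∀ S, 0 ≤ α S) (ε : ℝ) {n : ℕ} {Q : Finset P} (hne : Q.Nonempty)
    (F : P → Finset (Fin n)) :
    ∑ g : Fin n → antichains (Finset.univ : Finset P),
      (if ∀ y ∈ Q, copyMap (fun i => (g i : Finset P)) y = F y then typicalWeight α ε g else 0) ≤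
      Real.exp (-(n * (entropy (inducedWeighting Q α) - ε))) := by
  -- The fibre over a prescribed restriction has product mass determined by that restriction. If one
  -- typical sequence lies in it, typicality bounds the mass; if none does, the sum is zero.
  by_cases hex : ∃ g : Fin n → antichains (Finset.univ : Finset P), IsTypical α ε g ∧
      ∀ y ∈ Q, copyMap (fun i => (g i : Finset P)) y = F y
  · obtain ⟨g₀, hg₀, hF⟩ := hex
    refine le_trans ?_ (hg₀.2 Q hne)
    rw [inducedWeighting_eq_pushWeight,
      ← sum_prod_fiber (shadowIn Q) α fun i => shadowIn Q (g₀ i)]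
    refine Finset.sum_le_sum fun g _ => ?_
    have hnn : 0 ≤ ∏ i, α (g i) := Finset.prod_nonneg fun i _ => hα _
    by_cases h : ∀ y ∈ Q, copyMap (fun i => (g i : Finset P)) y = F y
    · have h2 : ∀ i, shadowIn Q (g i) = shadowIn Q (g₀ i) := fun i => by
        rw [shadowIn_eq_iff]
        intro x hx
        rw [← mem_copyMap (f := fun i => (g i : Finset P)), h x hx, ← hF x hx, mem_copyMap]
      rw [if_pos h, if_pos h2, typicalWeight]
      split_ifs
      exacts [le_rfl, hnn]
    · rw [if_neg h]
      split_ifs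
      exacts [hnn, le_rfl]
  · push Not at hex
    refine le_trans (le_of_eq (Finset.sum_eq_zero fun g _ => ?_)) (Real.exp_nonneg _)
    split_ifs with h
    · rw [typicalWeight, if_neg fun hT => ?_]
      obtain ⟨y, hy, hne'⟩ := hex g hT
      exact hne' (h y hy)
    · rfl

open Classical in
/-- The image of the map encoded by `f`. -/
noncomputable def copyImage {n : ℕ} (f : Fin n → antichains (Finset.univ : Finset P)) :
    Finset (Finset (Fin n)) :=
  Finset.univ.image (copyMap fun i => (f i : Finset P))

open Classical in
/-- The probability that two typical copies are both present. -/
theorem measureReal_inter_le {α : antichains (Finset.univ : Finset P) → ℝ} {ε c : ℝ} (hc : 0 < c)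
    {n : ℕ} {f g : Fin n → antichains (Finset.univ : Finset P)} (hf : IsTypical α ε f)
    (hg : IsTypical α ε g) :
    (randomPoset n (retainProb c hc n)).real
      ({R | (copyImage f : Set (Finset (Fin n))) ⊆ R} ∩
        {R | (copyImage g : Set (Finset (Fin n))) ⊆ R}) ≤
      (retainProb c hc n : ℝ) ^ (2 * Fintype.card P) * (1 + ∑ Q : Finset P, ∑ σ : P → P,
        if Q.Nonempty ∧ ∀ y ∈ Q, copyMap (fun i => (g i : Finset P)) y =
          copyMap (fun i => (f i : Finset P)) (σ y) then Real.exp (c * Q.card * n) else 0) := by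
  classical
  have hset : ({R | (copyImage f : Set (Finset (Fin n))) ⊆ R} ∩
        {R | (copyImage g : Set (Finset (Fin n))) ⊆ R}) =
      {R | ((copyImage f ∪ copyImage g : Finset _) : Set (Finset (Fin n))) ⊆ R} := by
    ext R
    simp
  have hcf : (copyImage f).card = Fintype.card P := Finset.card_image_of_injective _ hf.1
  have hcg : (copyImage g).card = Fintype.card P := Finset.card_image_of_injective _ hg.1
  -- `Q` is the part of the copy `g` that lies in the copy `f`. The union has `2 * card P - card Q`
  -- elements, which produces the factor `exp (c * card Q * n)`. Summing over all `Q` and `σ` avoids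
  -- naming the overlap, and the summand 1 covers disjoint copies.
  let Q : Finset P := Finset.univ.filter fun y => copyMap (fun i => (g i : Finset P)) y ∈ copyImage f
  have hQcard : (copyImage f ∩ copyImage g).card = Q.card := by
    rw [← Finset.card_image_of_injective Q hg.1]
    congr 1
    ext z
    simp only [Finset.mem_inter, Finset.mem_image, Q, Finset.mem_filter, Finset.mem_univ, true_and]
    constructor
    · rintro ⟨h1, h2⟩
      obtain ⟨y, -, rfl⟩ := Finset.mem_image.1 h2
      exact ⟨y, h1, rfl⟩
    · rintro ⟨y, h1, rfl⟩
      exact ⟨h1, Finset.mem_image.2 ⟨y, Finset.mem_univ _, rfl⟩⟩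
  have hcard : (copyImage f ∪ copyImage g).card + Q.card = 2 * Fintype.card P := by
    rw [← hQcard, Finset.card_union_add_card_inter, hcf, hcg, two_mul]
  have hprob : (retainProb c hc n : ℝ) ^ (copyImage f ∪ copyImage g).card =
      (retainProb c hc n : ℝ) ^ (2 * Fintype.card P) * Real.exp (c * Q.card * n) := by
    rw [retainProb_pow, retainProb_pow, ← hcard, ← Real.exp_add]
    congr 1
    push_cast
    ring
  rw [hset, randomPoset_real_superset, hprob]
  have hp : 0 ≤ (retainProb c hc n : ℝ) := (retainProb c hc n).2.1
  refine mul_le_mul_of_nonneg_left ?_ (pow_nonneg hp _)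
  have hnn : ∀ (Q' : Finset P) (σ : P → P), 0 ≤ if Q'.Nonempty ∧ ∀ y ∈ Q',
      copyMap (fun i => (g i : Finset P)) y = copyMap (fun i => (f i : Finset P)) (σ y)
      then Real.exp (c * Q'.card * n) else 0 := fun Q' σ => by
    split_ifs
    exacts [Real.exp_nonneg _, le_rfl]
  rcases Q.eq_empty_or_nonempty with he | hne
  · rw [he, Finset.card_empty, Nat.cast_zero, mul_zero, zero_mul, Real.exp_zero]
    exact le_add_of_nonneg_right (Finset.sum_nonneg fun Q' _ => Finset.sum_nonneg fun σ _ =>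
      hnn Q' σ)
  · have hσ : ∀ y, ∃ x, y ∈ Q → copyMap (fun i => (g i : Finset P)) y =
        copyMap (fun i => (f i : Finset P)) x := fun y => by
      by_cases hy : y ∈ Q
      · obtain ⟨x, -, hx⟩ := Finset.mem_image.1 (Finset.mem_filter.1 hy).2
        exact ⟨x, fun _ => hx.symm⟩
      · exact ⟨y, fun h => absurd h hy⟩
    choose σ hσ using hσ
    have h1 := Finset.single_le_sum (fun σ _ => hnn Q σ) (Finset.mem_univ σ)
    rw [if_pos ⟨hne, hσ⟩] at h1
    have h2 := Finset.single_le_sum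
      (fun Q' _ => Finset.sum_nonneg fun σ (_ : σ ∈ Finset.univ) => hnn Q' σ) (Finset.mem_univ Q)
    linarith

open Classical in
/-- Below the critical exponent there is a copy with high probability. -/
theorem holdsWhp_hasCopy {c c' : ℝ} (hc : 0 < c) (hcc' : c < c')
    {α : antichains (Finset.univ : Finset P) → ℝ} (hα : α ∈ stdSimplex ℝ _)
    (hQ : ∀ Q : Finset P, Q.Nonempty → c' ≤ criticalExponentIn α Q) :
    HoldsWhp c hc fun _ => {R | HasCopy P R} := by
  obtain ⟨c₁, hc₁, hc₁'⟩ := exists_between hcc'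
  obtain ⟨β, hβ, hpos, hβQ⟩ := exists_pos_weighting hα hc₁' hQ
  -- One `ε` is spent on typicality and the other remains as the decay rate; since `Q.card ≥ 1`, the
  -- gap `(c₁ - c) * Q.card` pays for both.
  obtain ⟨ε, hε, hεc⟩ : ∃ ε : ℝ, 0 < ε ∧ 2 * ε = c₁ - c := ⟨(c₁ - c) / 2, by linarith, by ring⟩
  let m : ℕ → ℝ := fun n =>
    ∑ f : Fin n → antichains (Finset.univ : Finset P), typicalWeight β ε f
  have hm : Tendsto m atTop (𝓝 1) := tendsto_sum_typicalWeight hβ hpos hε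
  let K : ℝ := (Fintype.card (Finset P) : ℝ) * Fintype.card (P → P)
  have hδ : Tendsto (fun n : ℕ => K * Real.exp (-ε * n)) atTop (𝓝 0) := by
    simpa using (tendsto_succ_pow_mul_exp_neg 0 hε).const_mul K
  have hb : Tendsto (fun n : ℕ => K * Real.exp (-ε * n) / m n ^ 2) atTop (𝓝 0) := by
    have h := hδ.div (hm.pow 2) (by norm_num)
    rwa [zero_div] at h
  refine holdsWhp_of_compl_le hb ?_
  filter_upwards [hm.eventually (lt_mem_nhds zero_lt_one)] with n hmn
  set μ := randomPoset n (retainProb c hc n) with hμ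
  set q : ℝ := (retainProb c hc n : ℝ) with hq
  have hqpos : 0 < q := Real.exp_pos _
  let A : (Fin n → antichains (Finset.univ : Finset P)) → Set (Set (Finset (Fin n))) := fun f =>
    {R | IsTypical β ε f ∧ (copyImage f : Set (Finset (Fin n))) ⊆ R}
  have hA : ∀ f, IsTypical β ε f → A f = {R | (copyImage f : Set (Finset (Fin n))) ⊆ R} :=
    fun f hf => by ext R; simp [A, hf]
  have hsub : ⋃ f, A f ⊆ {R | HasCopy P R} := by
    refine Set.iUnion_subset fun f R hR => ⟨_, hR.1.1, fun x => hR.2 ?_⟩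
    exact Finset.mem_coe.2 (Finset.mem_image_of_mem _ (Finset.mem_univ x))
  have hfirst : ∑ f, typicalWeight β ε f * μ.real (A f) = m n * q ^ Fintype.card P := by
    simp only [m, Finset.sum_mul]
    refine Finset.sum_congr rfl fun f _ => ?_
    by_cases hf : IsTypical β ε f
    · rw [hA f hf, hμ, randomPoset_real_superset, copyImage,
        Finset.card_image_of_injective _ hf.1, Finset.card_univ]
    · simp [typicalWeight, hf]
  let D : (Fin n → antichains (Finset.univ : Finset P)) →
      (Fin n → antichains (Finset.univ : Finset P)) → Finset P → (P → P) → ℝ := fun f g Q σ =>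
    if Q.Nonempty ∧ ∀ y ∈ Q, copyMap (fun i => (g i : Finset P)) y =
      copyMap (fun i => (f i : Finset P)) (σ y) then Real.exp (c * Q.card * n) else 0
  have hsecond : ∑ f, ∑ g, typicalWeight β ε f * typicalWeight β ε g * μ.real (A f ∩ A g) ≤
      q ^ (2 * Fintype.card P) * (m n ^ 2 + K * Real.exp (-ε * n)) := by
    have hpair : ∀ f g, typicalWeight β ε f * typicalWeight β ε g * μ.real (A f ∩ A g) ≤
        q ^ (2 * Fintype.card P) * (typicalWeight β ε f * typicalWeight β ε g +
          typicalWeight β ε f * ∑ Q : Finset P, ∑ σ : P → P,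
            D f g Q σ * typicalWeight β ε g) := by
      intro f g
      by_cases hf : IsTypical β ε f
      · by_cases hg : IsTypical β ε g
        · rw [hA f hf, hA g hg]
          have h := mul_le_mul_of_nonneg_left (measureReal_inter_le hc hf hg)
            (mul_nonneg (typicalWeight_nonneg hβ.1 ε f) (typicalWeight_nonneg hβ.1 ε g))
          refine h.trans_eq ?_
          change _ * (q ^ _ * (1 + ∑ Q, ∑ σ, D f g Q σ)) = _
          simp only [← Finset.sum_mul]
          ring
        · simp [typicalWeight, hg]
      · simp [typicalWeight, hf]
    refine (Finset.sum_le_sum fun f _ => Finset.sum_le_sum fun g _ => hpair f g).trans ?_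
    simp only [← Finset.mul_sum]
    refine mul_le_mul_of_nonneg_left ?_ (pow_nonneg hqpos.le _)
    simp only [Finset.sum_add_distrib]
    refine add_le_add (le_of_eq ?_) ?_
    · simp only [m, sq, Finset.sum_mul_sum]
    · simp only [← Finset.mul_sum]
      -- For fixed `f` and overlap pattern, the mass `exp (-n (H - ε))` of the sequences `g`
      -- agreeing with `f` beats the gain `exp (c * Q.card * n)` by a factor `exp (-ε n)`.
      have hinner : ∀ f, ∑ g, ∑ Q : Finset P, ∑ σ : P → P, D f g Q σ * typicalWeight β ε g ≤
          K * Real.exp (-ε * n) := by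
        intro f
        rw [Finset.sum_comm]
        have hQσ : ∀ (Q : Finset P) (σ : P → P), ∑ g, D f g Q σ * typicalWeight β ε g ≤
            Real.exp (-ε * n) := by
          intro Q σ
          by_cases hne : Q.Nonempty
          · have h1 := sum_typicalWeight_fiber_le hβ.1 ε (n := n) hne
              fun y => copyMap (fun i => (f i : Finset P)) (σ y)
            have h2 : ∑ g, D f g Q σ * typicalWeight β ε g = Real.exp (c * Q.card * n) *
                ∑ g : Fin n → antichains (Finset.univ : Finset P),
                (if ∀ y ∈ Q, copyMap (fun i => (g i : Finset P)) y =
                  copyMap (fun i => (f i : Finset P)) (σ y) then typicalWeight β ε g else 0) := by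
              rw [Finset.mul_sum]
              refine Finset.sum_congr rfl fun g _ => ?_
              simp only [D, hne, true_and]
              split_ifs <;> simp
            rw [h2]
            refine (mul_le_mul_of_nonneg_left h1 (Real.exp_nonneg _)).trans ?_
            rw [← Real.exp_add, Real.exp_le_exp]
            have hcardpos : (0 : ℝ) < Q.card := by exact_mod_cast Finset.card_pos.2 hne
            have hcard1 : (1 : ℝ) ≤ Q.card := by exact_mod_cast Finset.card_pos.2 hne
            have h3 := hβQ Q hne
            rw [criticalExponentIn, le_div_iff₀ hcardpos] at h3
            have h4 : c * Q.card + ε ≤ entropy (inducedWeighting Q β) - ε := by nlinarith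
            have h5 : (0 : ℝ) ≤ n := Nat.cast_nonneg n
            nlinarith
          · refine le_trans (le_of_eq (Finset.sum_eq_zero fun g _ => ?_)) (Real.exp_nonneg _)
            simp [D, hne]
        calc _ ≤ ∑ _Q : Finset P, ∑ _σ : P → P, Real.exp (-ε * n) := by
              refine Finset.sum_le_sum fun Q _ => ?_
              rw [Finset.sum_comm]
              exact Finset.sum_le_sum fun σ _ => hQσ Q σ
          _ = K * Real.exp (-ε * n) := by
              simp only [Finset.sum_const, Finset.card_univ, nsmul_eq_mul, K]
              ring
      have hKe : 0 ≤ K * Real.exp (-ε * n) := by positivity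
      calc _ ≤ ∑ f : Fin n → antichains (Finset.univ : Finset P),
            typicalWeight β ε f * (K * Real.exp (-ε * n)) :=
          Finset.sum_le_sum fun f _ =>
            mul_le_mul_of_nonneg_left (hinner f) (typicalWeight_nonneg hβ.1 ε f)
        _ ≤ K * Real.exp (-ε * n) := by
          rw [← Finset.sum_mul]
          exact mul_le_of_le_one_left hKe (sum_typicalWeight_le_one hβ ε n)
  have hcs := sq_sum_measureReal_le μ A (typicalWeight β ε)
  rw [hfirst] at hcs
  have hU : μ.real (⋃ f, A f) ≤ μ.real {R | HasCopy P R} := measureReal_mono hsub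
  have hU1 : μ.real (⋃ f, A f) ≤ 1 := measureReal_le_one
  have hU0 : 0 ≤ μ.real (⋃ f, A f) := measureReal_nonneg
  have h1 := hcs.trans (mul_le_mul_of_nonneg_left hsecond hU0)
  have hq2 : 0 < q ^ (2 * Fintype.card P) := pow_pos hqpos _
  have h2 : m n ^ 2 ≤ μ.real (⋃ f, A f) * (m n ^ 2 + K * Real.exp (-ε * n)) := by
    refine le_of_mul_le_mul_left ?_ hq2
    calc _ = (m n * q ^ Fintype.card P) ^ 2 := by ring
      _ ≤ _ := h1
      _ = _ := by ring
  rw [measureReal_compl (by exact MeasurableSet.of_discrete), probReal_univ,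
    le_div_iff₀ (pow_pos hmn 2)]
  have hKe : 0 ≤ K * Real.exp (-ε * n) := by positivity
  have h3 : μ.real (⋃ f, A f) * (K * Real.exp (-ε * n)) ≤ K * Real.exp (-ε * n) :=
    mul_le_of_le_one_left hKe hU1
  have h4 : 0 ≤ (μ.real {R | HasCopy P R} - μ.real (⋃ f, A f)) * m n ^ 2 :=
    mul_nonneg (sub_nonneg.2 hU) (sq_nonneg _)
  nlinarith

end SecondMoment

/-! ### Monochromatic `V` and the greedy colouring -/

section Colouring

variable {R : Type*} [PartialOrder R]

theorem exists_vee_iff (p : R → Prop) :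
    (∃ φ : Vee →o R, Function.Injective φ ∧ ∀ x, p (φ x)) ↔
      ∃ x y z, x < y ∧ x < z ∧ y ≠ z ∧ p x ∧ p y ∧ p z := by
  constructor
  · rintro ⟨φ, hinj, hp⟩
    refine ⟨φ .A, φ .B, φ .C, ?_, ?_, hinj.ne (by decide), hp _, hp _, hp _⟩
    · exact lt_of_le_of_ne (φ.monotone (show Vee.le .A .B = true from rfl)) (hinj.ne (by decide))
    · exact lt_of_le_of_ne (φ.monotone (show Vee.le .A .C = true from rfl)) (hinj.ne (by decide))
  · rintro ⟨x, y, z, hxy, hxz, hyz, hx, hy, hz⟩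
    let φ : Vee → R := fun | .A => x | .B => y | .C => z
    refine ⟨⟨φ, fun a b h => ?_⟩, fun a b h => ?_, fun a => ?_⟩
    · change Vee.le a b = true at h
      cases a <;> cases b <;> simp_all [φ, Vee.le, le_of_lt]
    · change φ a = φ b at h
      cases a <;> cases b <;> simp_all [φ, hxy.ne, hxz.ne, hxy.ne', hxz.ne', eq_comm]
    · cases a <;> assumption

theorem isRamsey_vee_iff : IsRamsey Vee Vee R ↔ ∀ χ : R → Bool,
    (∃ x y z, x < y ∧ x < z ∧ y ≠ z ∧ χ x = true ∧ χ y = true ∧ χ z = true) ∨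
    (∃ x y z, x < y ∧ x < z ∧ y ≠ z ∧ χ x = false ∧ χ y = false ∧ χ z = false) := by
  exact forall_congr' fun χ => or_congr (exists_vee_iff fun r => χ r = true)
    (exists_vee_iff fun r => χ r = false)

/-- Every `2`-colouring of the binary tree of height `3` has a monochromatic `V`. -/
theorem isRamsey_vee_of_binTree (φ : BinTree →o R) (hφ : Function.Injective φ) :
    IsRamsey Vee Vee R := by
  rw [isRamsey_vee_iff]
  have hlt : ∀ a b : BinTree, BinTree.le a b = true → a ≠ b → φ a < φ b := fun a b h hne =>
    lt_of_le_of_ne (φ.monotone h) (hφ.ne hne)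
  -- Let the root have colour `s`. If both copies of `V` above it contain an element of colour `s`,
  -- those two elements and the root form a `V`; otherwise one of the copies is monochromatic in
  -- `t`.
  have key : ∀ (χ : R → Bool) (s t : Bool), s = !t → χ (φ .A) = s →
      (∃ x y z, x < y ∧ x < z ∧ y ≠ z ∧ χ x = s ∧ χ y = s ∧ χ z = s) ∨
      (∃ x y z, x < y ∧ x < z ∧ y ≠ z ∧ χ x = t ∧ χ y = t ∧ χ z = t) := by
    intro χ s t hst hA
    have hbool : ∀ s t u : Bool, (s = !t) → u ≠ s → u = t := by decide
    have hsplit : ∀ b, χ (φ b) ≠ s → χ (φ b) = t := fun b => hbool s t _ hst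
    have hsub : ∀ a b c : BinTree, BinTree.le a b = true → a ≠ b → BinTree.le a c = true → a ≠ c →
        b ≠ c → (∃ d, (d = a ∨ d = b ∨ d = c) ∧ χ (φ d) = s) ∨
        (∃ x y z, x < y ∧ x < z ∧ y ≠ z ∧ χ x = t ∧ χ y = t ∧ χ z = t) := by
      intro a b c hab hab' hac hac' hbc
      by_cases h : ∃ d, (d = a ∨ d = b ∨ d = c) ∧ χ (φ d) = s
      · exact Or.inl h
      · push Not at h
        exact Or.inr ⟨φ a, φ b, φ c, hlt _ _ hab hab', hlt _ _ hac hac', hφ.ne hbc,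
          hsplit _ (h a (by simp)), hsplit _ (h b (by simp)), hsplit _ (h c (by simp))⟩
    rcases hsub .B .C .D rfl (by decide) rfl (by decide) (by decide) with ⟨d, hd, hds⟩ | h
    · rcases hsub .E .F .G rfl (by decide) rfl (by decide) (by decide) with ⟨e, he, hes⟩ | h
      · refine Or.inl ⟨φ .A, φ d, φ e, ?_, ?_, hφ.ne ?_, hA, hds, hes⟩
        · rcases hd with rfl | rfl | rfl <;> exact hlt _ _ rfl (by decide)
        · rcases he with rfl | rfl | rfl <;> exact hlt _ _ rfl (by decide)
        · rcases hd with rfl | rfl | rfl <;> rcases he with rfl | rfl | rfl <;> decide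
      · exact Or.inr h
    · exact Or.inr h
  intro χ
  cases hA : χ (φ .A)
  · exact (key χ false true rfl hA).symm
  · exact key χ true false rfl hA

/-- Colouring from the top: an element gets the first colour unless two elements above it
already have it. -/
theorem exists_greedy_colouring [Finite R] : ∃ p : R → Prop, ∀ x, p x ↔
    ¬ ∃ y z, x < y ∧ x < z ∧ y ≠ z ∧ p y ∧ p z := by
  have wf : WellFounded (fun a b : R => b < a) := wellFounded_gt
  let F : ∀ x : R, (∀ y, x < y → Prop) → Prop := fun x ih =>
    ¬ ∃ (y z : R) (hy : x < y) (hz : x < z), y ≠ z ∧ ih y hy ∧ ih z hz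
  refine ⟨wf.fix F, fun x => ?_⟩
  rw [wf.fix_eq]
  simp only [F, exists_prop]

theorem exists_binTree {x y z a b c d : R} (hxy : x < y) (hxz : x < z) (hya : y < a) (hyb : y < b)
    (hzc : z < c) (hzd : z < d) (hnd : [x, y, a, b, z, c, d].Nodup) :
    ∃ φ : BinTree →o R, Function.Injective φ := by
  let φ : BinTree → R := fun | .A => x | .B => y | .C => a | .D => b | .E => z | .F => c | .G => d
  refine ⟨⟨φ, fun s t h => ?_⟩, fun s t h => ?_⟩
  · have hxa := (hxy.trans hya).le
    have hxb := (hxy.trans hyb).le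
    have hxc := (hxz.trans hzc).le
    have hxd := (hxz.trans hzd).le
    change BinTree.le s t = true at h
    cases s <;> cases t <;> first | exact le_rfl | assumption | exact le_of_lt ‹_› | cases h
  · change φ s = φ t at h
    let idx : BinTree → Fin 7 := fun
      | .A => 0 | .B => 1 | .C => 2 | .D => 3 | .E => 4 | .F => 5 | .G => 6
    have hφ : ∀ s, φ s = [x, y, a, b, z, c, d].get (idx s) := fun s => by cases s <;> rfl
    rw [hφ, hφ] at h
    have := List.nodup_iff_injective_get.1 hnd h
    revert this
    cases s <;> cases t <;> simp [idx]

/-- A set of pairs on `Fin k` is realised in `R` by distinct elements. -/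
def Realises (R : Type*) [PartialOrder R] {k : ℕ} (r : List (Fin k × Fin k)) : Prop :=
  ∃ φ : Fin k → R, Function.Injective φ ∧ ∀ e ∈ r, φ e.1 ≤ φ e.2

/-- Two elements above a bottom element, below two and two elements that share one. -/
def sharedTree : List (Fin 6 × Fin 6) := [(0, 1), (0, 2), (1, 3), (1, 4), (2, 4), (2, 5)]

/-- Two elements above a bottom element, both below the same two elements. -/
def doubleTree : List (Fin 5 × Fin 5) := [(0, 1), (0, 2), (1, 3), (1, 4), (2, 3), (2, 4)]

theorem realises_sharedTree {x y z a b d : R} (hxy : x < y) (hxz : x < z) (hya : y < a)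
    (hyb : y < b) (hzb : z < b) (hzd : z < d) (hnd : [x, y, z, a, b, d].Nodup) :
    Realises R sharedTree := by
  refine ⟨[x, y, z, a, b, d].get, List.nodup_iff_injective_get.1 hnd, ?_⟩
  simp [sharedTree, hxy.le, hxz.le, hya.le, hyb.le, hzb.le, hzd.le]

theorem realises_doubleTree {x y z a b : R} (hxy : x < y) (hxz : x < z) (hya : y < a)
    (hyb : y < b) (hza : z < a) (hzb : z < b) (hnd : [x, y, z, a, b].Nodup) :
    Realises R doubleTree := by
  refine ⟨[x, y, z, a, b].get, List.nodup_iff_injective_get.1 hnd, ?_⟩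
  simp [doubleTree, hxy.le, hxz.le, hya.le, hyb.le, hzb.le, hza.le]

/-- In the greedy colouring only the second colour can contain a `V`. Each of its two upper elements
was refused the first colour because of two elements above it, and the three outcomes record how
these two pairs overlap. -/
theorem IsRamsey.binTree_or [Finite R] (h : IsRamsey Vee Vee R) :
    (∃ φ : BinTree →o R, Function.Injective φ) ∨ Realises R sharedTree ∨
      Realises R doubleTree := by
  classical
  obtain ⟨p, hp⟩ := exists_greedy_colouring (R := R)
  rcases isRamsey_vee_iff.1 h fun x => decide (p x) with
    ⟨x, y, z, hxy, hxz, hyz, hx, hy, hz⟩ | ⟨x, y, z, hxy, hxz, hyz, hx, hy, hz⟩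
  · simp only [decide_eq_true_eq] at hx hy hz
    exact absurd ⟨y, z, hxy, hxz, hyz, hy, hz⟩ ((hp x).1 hx)
  · simp only [decide_eq_false_iff_not] at hx hy hz
    have hy' := hy
    have hz' := hz
    rw [hp, not_not] at hy' hz'
    obtain ⟨a, b, hya, hyb, hab, ha, hb⟩ := hy'
    obtain ⟨c, d, hzc, hzd, hcd, hc, hd⟩ := hz'
    -- Elements of different colours are distinct, so only coincidences between the pairs `a, b` and
    -- `c, d` need a case analysis.
    have hlow : ∀ {u v : R}, ¬ p u → p v → u ≠ v := fun hu hv huv => hu (huv ▸ hv)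
    have shared : ∀ {a b d : R}, y < a → y < b → z < b → z < d → a ≠ b → a ≠ d → b ≠ d →
        p a → p b → p d → Realises R sharedTree := by
      intro a b d hya hyb hzb hzd hab had hbd ha hb hd
      exact realises_sharedTree hxy hxz hya hyb hzb hzd (by
        simp [hxy.ne, hxz.ne, hyz, hlow hx, hlow hy, hlow hz, ha, hb, hd, hab, had, hbd])
    by_cases hac : a = c
    · subst hac
      by_cases hbd : b = d
      · subst hbd
        exact Or.inr (Or.inr (realises_doubleTree hxy hxz hya hyb hzc hzd (by
          simp [hxy.ne, hxz.ne, hyz, hlow hx, hlow hy, hlow hz, ha, hb, hab])))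
      · exact Or.inr (Or.inl (shared hyb hya hzc hzd hab.symm hbd hcd hb ha hd))
    by_cases had : a = d
    · subst had
      by_cases hbc : b = c
      · subst hbc
        exact Or.inr (Or.inr (realises_doubleTree hxy hxz hya hyb hzd hzc (by
          simp [hxy.ne, hxz.ne, hyz, hlow hx, hlow hy, hlow hz, ha, hb, hab])))
      · exact Or.inr (Or.inl (shared hyb hya hzd hzc hab.symm hbc hac hb ha hc))
    by_cases hbc : b = c
    · subst hbc
      exact Or.inr (Or.inl (shared hya hyb hzc hzd hab had hcd ha hb hd))
    by_cases hbd : b = d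
    · subst hbd
      exact Or.inr (Or.inl (shared hya hyb hzd hzc hab hac hcd.symm ha hb hc))
    exact Or.inl (exists_binTree hxy hxz hya hyb hzc hzd (by
      simp [hxy.ne, hxz.ne, hyz, hlow hx, hlow hy, (hlow hz _).symm, hlow hz, ha, hb, hc, hd, hab,
        hac, had, hbc, hbd, hcd]))

end Colouring

/-! ### Order reversal by complementation -/

theorem exists_dual_copy_iff {T R S : Type*} [PartialOrder T] [PartialOrder R] [PartialOrder S]
    (e : R ≃o Sᵒᵈ) (p : S → Prop) :
    (∃ φ : Tᵒᵈ →o R, Function.Injective φ ∧ ∀ x, p (OrderDual.ofDual (e (φ x)))) ↔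
      ∃ φ : T →o S, Function.Injective φ ∧ ∀ x, p (φ x) := by
  constructor
  · rintro ⟨φ, hinj, hp⟩
    refine ⟨⟨fun x => OrderDual.ofDual (e (φ (OrderDual.toDual x))), fun x y h => ?_⟩,
      fun x y h => ?_, fun x => hp _⟩
    · exact e.monotone (φ.monotone (OrderDual.toDual_le_toDual.2 h))
    · exact OrderDual.toDual.injective (hinj (e.injective (OrderDual.ofDual.injective h)))
  · rintro ⟨φ, hinj, hp⟩
    refine ⟨⟨fun x => e.symm (OrderDual.toDual (φ (OrderDual.ofDual x))), fun x y h => ?_⟩,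
      fun x y h => ?_, fun x => ?_⟩
    · exact e.symm.monotone (OrderDual.toDual_le_toDual.2 (φ.monotone h))
    · exact OrderDual.ofDual.injective (hinj (OrderDual.toDual.injective (e.symm.injective h)))
    · change p (OrderDual.ofDual (e (e.symm _)))
      rw [OrderIso.apply_symm_apply]
      exact hp (OrderDual.ofDual x)

/-- Reversing the order of the host poset. -/
theorem isRamsey_dual_iff {P Q R S : Type*} [PartialOrder P] [PartialOrder Q] [PartialOrder R]
    [PartialOrder S] (e : R ≃o Sᵒᵈ) : IsRamsey Pᵒᵈ Qᵒᵈ R ↔ IsRamsey P Q S := by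
  constructor
  · intro h χ
    have := h fun r => χ (OrderDual.ofDual (e r))
    rwa [exists_dual_copy_iff e fun s => χ s = true,
      exists_dual_copy_iff e fun s => χ s = false] at this
  · intro h χ
    have := h fun s => χ (e.symm (OrderDual.toDual s))
    rw [← exists_dual_copy_iff e fun s => χ (e.symm (OrderDual.toDual s)) = true,
      ← exists_dual_copy_iff e fun s => χ (e.symm (OrderDual.toDual s)) = false] at this
    simpa using this

theorem isRamsey_wedge_iff {n : ℕ} (R : Set (Finset (Fin n))) :
    IsRamsey Wedge Wedge R ↔ IsRamsey Vee Vee (compl '' R : Set (Finset (Fin n))) := by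
  refine isRamsey_dual_iff (P := Vee) (Q := Vee) (S := (compl '' R : Set (Finset (Fin n)))) ?_
  refine ⟨(Equiv.Set.image compl R compl_injective).trans OrderDual.toDual, fun {a b} => ?_⟩
  change ((b : Finset (Fin n))ᶜ ≤ (a : Finset (Fin n))ᶜ) ↔ _
  rw [compl_le_compl_iff_le]
  rfl

/-! ### The degenerate configurations -/

/-- The union bound for a fixed family of relations. -/
theorem holdsWhp_not_realises {k : ℕ} (hk : 0 < k) (r : List (Fin k × Fin k)) {N : ℕ}
    (hN : (Finset.univ.filter fun U : Finset (Fin k) => ∀ e ∈ r, e.1 ∈ U → e.2 ∈ U).card = N)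
    {c : ℝ} (hc : 0 < c) (h : Real.log N / k < c) :
    HoldsWhp c hc fun _ => {R | ¬ Realises R r} := by
  classical
  have hk' : (0 : ℝ) < k := Nat.cast_pos.2 hk
  rw [div_lt_iff₀ hk'] at h
  have hNpos : 0 < N := by
    rw [← hN]
    exact Finset.card_pos.2 ⟨∅, by simp⟩
  have hlim : Tendsto (fun n : ℕ => Real.exp (-(c * k - Real.log N) * n)) atTop (𝓝 0) := by
    simpa using tendsto_succ_pow_mul_exp_neg 0 (sub_pos.2 h)
  refine holdsWhp_of_compl_le hlim (Eventually.of_forall fun n => ?_)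
  let Φ : Finset (Fin k → Finset (Fin n)) := Finset.univ.filter fun φ =>
    Function.Injective φ ∧ ∀ e ∈ r, φ e.1 ≤ φ e.2
  have hΦ : Φ.card ≤ N ^ n := by
    rw [← hN]
    let T := Finset.univ.filter fun U : Finset (Fin k) => ∀ e ∈ r, e.1 ∈ U → e.2 ∈ U
    have hT : T.card ^ n = (Fintype.piFinset fun _ : Fin n => T).card := by simp
    change _ ≤ T.card ^ n
    rw [hT]
    -- Each coordinate `i` selects the set `{a | i ∈ φ a}`, which is closed upwards under `r`; hence
    -- at most `N` choices per coordinate.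
    refine Finset.card_le_card_of_injOn (fun φ i => Finset.univ.filter fun a => i ∈ φ a) ?_ ?_
    · intro φ hφ
      rw [Finset.mem_coe, Fintype.mem_piFinset]
      intro i
      refine Finset.mem_filter.2 ⟨Finset.mem_univ _, fun e he hi => ?_⟩
      simp only [Finset.mem_filter, Finset.mem_univ, true_and] at hi ⊢
      exact (Finset.mem_filter.1 hφ).2.2 e he hi
    · intro φ _ ψ _ heq
      ext a i
      have := congrArg (fun F : Fin n → Finset (Fin k) => a ∈ F i) heq
      simpa using this
  have hsub : {R : Set (Finset (Fin n)) | ¬ Realises R r}ᶜ ⊆ ⋃ φ ∈ Φ,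
      {R | ((Finset.univ.image φ : Finset (Finset (Fin n))) : Set (Finset (Fin n))) ⊆ R} := by
    intro R hR
    simp only [Set.mem_compl_iff, Set.mem_ofPred_eq, not_not] at hR
    obtain ⟨φ, hinj, hle⟩ := hR
    simp only [Set.mem_iUnion]
    refine ⟨fun a => φ a, Finset.mem_filter.2 ⟨Finset.mem_univ _,
      Subtype.val_injective.comp hinj, hle⟩, ?_⟩
    intro z hz
    obtain ⟨a, -, rfl⟩ := Finset.mem_image.1 (Finset.mem_coe.1 hz)
    exact (φ a).2
  refine (measureReal_mono hsub (measure_ne_top _ _)).trans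
    ((measureReal_biUnion_finset_le _ _).trans ?_)
  have hp : ∀ φ ∈ Φ, (randomPoset n (retainProb c hc n)).real
      {R | ((Finset.univ.image φ : Finset (Finset (Fin n))) : Set (Finset (Fin n))) ⊆ R} =
      Real.exp (-(c * k) * n) := fun φ hφ => by
    rw [randomPoset_real_superset, Finset.card_image_of_injective _ (Finset.mem_filter.1 hφ).2.1,
      Finset.card_univ, Fintype.card_fin, retainProb_pow]
  rw [Finset.sum_congr rfl hp, Finset.sum_const, nsmul_eq_mul]
  have hΦ' : (Φ.card : ℝ) ≤ Real.exp (n * Real.log N) := by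
    rw [Real.exp_nat_mul, Real.exp_log (Nat.cast_pos.2 hNpos)]
    exact_mod_cast hΦ
  refine (mul_le_mul_of_nonneg_right hΦ' (Real.exp_nonneg _)).trans_eq ?_
  rw [← Real.exp_add]
  congr 1
  ring

theorem card_upset_sharedTree : (Finset.univ.filter fun U : Finset (Fin 6) =>
    ∀ e ∈ sharedTree, e.1 ∈ U → e.2 ∈ U).card = 14 := by
  decide +kernel

theorem card_upset_doubleTree : (Finset.univ.filter fun U : Finset (Fin 5) =>
    ∀ e ∈ doubleTree, e.1 ∈ U → e.2 ∈ U).card = 8 := by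
  decide +kernel

/-! ### Entropy of push-forwards, products and mixtures -/

section Entropy

variable {ι κ : Type*} [Fintype ι]

/-- Writing the entropy as an expectation over the source avoids describing the values of `γ`. -/
theorem entropy_pushWeight [Fintype κ] (γ : ι → κ) (α : ι → ℝ) :
    entropy (pushWeight γ α) = ∑ S, α S * -Real.log (pushWeight γ α (γ S)) := by
  rw [← sum_pushWeight_mul γ α fun k => -Real.log (pushWeight γ α k), entropy]
  refine Finset.sum_congr rfl fun k _ => ?_
  simp [Real.negMulLog]

theorem sum_pushWeight [Fintype κ] (γ : ι → κ) (α : ι → ℝ) : ∑ k, pushWeight γ α k = ∑ S, α S := by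
  simpa using sum_pushWeight_mul γ α fun _ => 1

theorem pushWeight_mem_stdSimplex [Fintype κ] (γ : ι → κ) {α : ι → ℝ} (hα : α ∈ stdSimplex ℝ ι) :
    pushWeight γ α ∈ stdSimplex ℝ κ :=
  ⟨pushWeight_nonneg hα.1, (sum_pushWeight γ α).trans hα.2⟩

theorem entropy_nonneg [Fintype κ] {β : κ → ℝ} (hβ : β ∈ stdSimplex ℝ κ) : 0 ≤ entropy β :=
  Finset.sum_nonneg fun k _ => Real.negMulLog_nonneg (hβ.1 k)
    (hβ.2 ▸ Finset.single_le_sum (fun j _ => hβ.1 j) (Finset.mem_univ k))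

theorem pushWeight_pushWeight {Ω : Type*} [Fintype Ω] (G : Ω → ι) (γ : ι → κ) (w : Ω → ℝ) :
    pushWeight γ (pushWeight G w) = pushWeight (fun ω => γ (G ω)) w := by
  classical
  ext k
  have h := sum_pushWeight_mul G w fun S => if γ S = k then 1 else 0
  simp only [mul_ite, mul_one, mul_zero] at h
  rw [pushWeight, pushWeight]
  convert h

/-- The entropy of a product weighting is additive. -/
theorem entropy_pushWeight_prod [Fintype κ] {ι' κ₁ κ₂ : Type*} [Fintype ι'] [Fintype κ₁] [Fintype κ₂]
    {γ : ι × ι' → κ} {γ₁ : ι → κ₁} {γ₂ : ι' → κ₂}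
    (hγ : ∀ a a' b b', γ (a, b) = γ (a', b') ↔ γ₁ a = γ₁ a' ∧ γ₂ b = γ₂ b')
    {α : ι → ℝ} {β : ι' → ℝ} (hα : α ∈ stdSimplex ℝ ι) (hβ : β ∈ stdSimplex ℝ ι') :
    entropy (pushWeight γ fun ω => α ω.1 * β ω.2) =
      entropy (pushWeight γ₁ α) + entropy (pushWeight γ₂ β) := by
  classical
  have hmass : ∀ a b, pushWeight γ (fun ω => α ω.1 * β ω.2) (γ (a, b)) =
      pushWeight γ₁ α (γ₁ a) * pushWeight γ₂ β (γ₂ b) := by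
    intro a b
    simp only [pushWeight]
    rw [Finset.sum_mul_sum, Fintype.sum_prod_type]
    refine Finset.sum_congr rfl fun a' _ => Finset.sum_congr rfl fun b' _ => ?_
    by_cases h1 : γ₁ a' = γ₁ a <;> by_cases h2 : γ₂ b' = γ₂ b <;> simp [hγ, h1, h2]
  have hterm : ∀ a b, α a * β b * -Real.log (pushWeight γ₁ α (γ₁ a) * pushWeight γ₂ β (γ₂ b)) =
      (α a * -Real.log (pushWeight γ₁ α (γ₁ a))) * β b +
        α a * (β b * -Real.log (pushWeight γ₂ β (γ₂ b))) := by
    intro a b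
    rcases (hα.1 a).eq_or_lt with ha | ha
    · simp [← ha]
    rcases (hβ.1 b).eq_or_lt with hb | hb
    · simp [← hb]
    rw [Real.log_mul (ha.trans_le (le_pushWeight hα.1 a)).ne'
      (hb.trans_le (le_pushWeight hβ.1 b)).ne']
    ring
  simp only [entropy_pushWeight, Fintype.sum_prod_type, hmass, hterm, Finset.sum_add_distrib]
  simp only [← Finset.mul_sum, ← Finset.sum_mul, hα.2, hβ.2, mul_one, one_mul]

/-- The weighting of `Bool × ι` under which the first coordinate is `true` with probability `t`. -/
noncomputable def bernoulliMix (t : ℝ) (w : ι → ℝ) (ω : Bool × ι) : ℝ :=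
  (if ω.1 then t else 1 - t) * w ω.2

theorem bernoulliMix_mem_stdSimplex {t : ℝ} (h0 : 0 ≤ t) (h1 : t ≤ 1) {w : ι → ℝ}
    (hw : w ∈ stdSimplex ℝ ι) : bernoulliMix t w ∈ stdSimplex ℝ (Bool × ι) := by
  refine ⟨fun ω => mul_nonneg ?_ (hw.1 _), ?_⟩
  · split_ifs
    exacts [h0, sub_nonneg.2 h1]
  · simp [bernoulliMix, Fintype.sum_prod_type, ← Finset.mul_sum, hw.2]

theorem pushWeight_bernoulliMix (γ : Bool × ι → κ) (t : ℝ) (w : ι → ℝ) (k : κ) :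
    pushWeight γ (bernoulliMix t w) k = t * pushWeight (fun a => γ (true, a)) w k +
      (1 - t) * pushWeight (fun a => γ (false, a)) w k := by
  simp only [pushWeight, bernoulliMix, Fintype.sum_prod_type, Fintype.sum_bool, Finset.mul_sum]
  simp

/-- Concavity of entropy, with the nonnegative contribution of the `true` branch discarded. -/
theorem le_entropy_bernoulliMix [Fintype κ] (γ : Bool × ι → κ) {t : ℝ} (h0 : 0 ≤ t) (h1 : t ≤ 1) {w : ι → ℝ}
    (hw : w ∈ stdSimplex ℝ ι) :
    (1 - t) * entropy (pushWeight (fun a => γ (false, a)) w) ≤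
      entropy (pushWeight γ (bernoulliMix t w)) := by
  have h2 : t * entropy (pushWeight (fun a => γ (true, a)) w) +
      (1 - t) * entropy (pushWeight (fun a => γ (false, a)) w) ≤
      entropy (pushWeight γ (bernoulliMix t w)) := by
    simp only [entropy, Finset.mul_sum, ← Finset.sum_add_distrib, pushWeight_bernoulliMix]
    exact Finset.sum_le_sum fun k _ => Real.concaveOn_negMulLog.2 (pushWeight_nonneg hw.1 k)
      (pushWeight_nonneg hw.1 k) h0 (sub_nonneg.2 h1) (by ring)
  have h3 := mul_nonneg h0 (entropy_nonneg (pushWeight_mem_stdSimplex (fun a => γ (true, a)) hw))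
  linarith

/-- When the value reveals the Boolean, the two branches have disjoint supports and the chain rule
adds the full entropy of the coin. -/
theorem le_entropy_bernoulliMix_of_ne [Fintype κ] {γ : Bool × ι → κ}
    (hγ : ∀ a b, γ (true, a) ≠ γ (false, b)) {t : ℝ} (h0 : 0 ≤ t) {w : ι → ℝ}
    (hw : w ∈ stdSimplex ℝ ι) :
    Real.negMulLog t + Real.negMulLog (1 - t) +
      (1 - t) * entropy (pushWeight (fun a => γ (false, a)) w) ≤
      entropy (pushWeight γ (bernoulliMix t w)) := by
  classical
  have hk : ∀ k, Real.negMulLog (pushWeight γ (bernoulliMix t w) k) =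
      pushWeight (fun a => γ (true, a)) w k * Real.negMulLog t +
      t * Real.negMulLog (pushWeight (fun a => γ (true, a)) w k) +
      (pushWeight (fun a => γ (false, a)) w k * Real.negMulLog (1 - t) +
      (1 - t) * Real.negMulLog (pushWeight (fun a => γ (false, a)) w k)) := by
    intro k
    rw [pushWeight_bernoulliMix]
    by_cases h : ∃ a, γ (true, a) = k
    · obtain ⟨a, rfl⟩ := h
      have hz : pushWeight (fun b => γ (false, b)) w (γ (true, a)) = 0 :=
        Finset.sum_eq_zero fun b _ => if_neg fun hb => hγ a b hb.symm
      rw [hz, mul_zero, add_zero, Real.negMulLog_mul]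
      simp
    · have hz : pushWeight (fun b => γ (true, b)) w k = 0 :=
        Finset.sum_eq_zero fun b _ => if_neg fun hb => h ⟨b, hb⟩
      rw [hz, mul_zero, zero_add, Real.negMulLog_mul]
      simp
  have h3 := mul_nonneg h0 (entropy_nonneg (pushWeight_mem_stdSimplex (fun a => γ (true, a)) hw))
  have hsum : entropy (pushWeight γ (bernoulliMix t w)) =
      Real.negMulLog t + t * entropy (pushWeight (fun a => γ (true, a)) w) +
      (Real.negMulLog (1 - t) + (1 - t) * entropy (pushWeight (fun a => γ (false, a)) w)) := by
    rw [entropy]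
    simp only [hk, Finset.sum_add_distrib, ← Finset.sum_mul, ← Finset.mul_sum, sum_pushWeight,
      hw.2, one_mul]
    rfl
  linarith

end Entropy

/-! ### A lower bound for the critical exponent of `T₂` -/

section BinTreeExponent

/-- A weighting of the five up-sets of `V`, listed from the largest to the smallest. -/
noncomputable def veeWeight : Fin 5 → ℝ := ![1 / 4, 3 / 16, 3 / 16, 3 / 16, 3 / 16]

/-- Membership of the root in the up-sets of `V`. -/
def inRoot : Fin 5 → Bool := ![true, false, false, false, false]

/-- Membership of the first leaf in the up-sets of `V`. -/
def inLeaf₁ : Fin 5 → Bool := ![true, true, true, false, false]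

/-- Membership of the second leaf in the up-sets of `V`. -/
def inLeaf₂ : Fin 5 → Bool := ![true, true, false, true, false]

theorem veeWeight_mem_stdSimplex : veeWeight ∈ stdSimplex ℝ (Fin 5) := by
  refine ⟨fun a => ?_, ?_⟩
  · fin_cases a <;> norm_num [veeWeight]
  · simp [veeWeight, Fin.sum_univ_succ]
    norm_num

/-- The trace of an up-set of `V` on a subset. -/
def veeTrace (q : Bool × Bool × Bool) (a : Fin 5) : Bool × Bool × Bool :=
  (q.1 && inRoot a, q.2.1 && inLeaf₁ a, q.2.2 && inLeaf₂ a)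

/-- The number of elements of a subset of `V`. -/
def veeCard (q : Bool × Bool × Bool) : ℕ := q.1.toNat + q.2.1.toNat + q.2.2.toNat

theorem mul_log_le_of_pow_le {a b k l : ℕ} (ha : 0 < a) (h : a ^ k ≤ b ^ l) :
    k * Real.log a ≤ l * Real.log b := by
  rw [← Real.log_pow, ← Real.log_pow]
  exact Real.log_le_log (by positivity) (by exact_mod_cast h)

theorem log_fourteen_eq : Real.log 14 = Real.log 2 + Real.log 7 := by
  rw [← Real.log_mul (by norm_num) (by norm_num)]; norm_num

/-- Comparisons of integer powers, such as `2 ^ 79 ≤ 3 ^ 50`. With every logarithm bounded by a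
multiple of `log 2`, the entropy estimates become linear. -/
theorem log_bounds : 1.58 * Real.log 2 ≤ Real.log 3 ∧ Real.log 3 ≤ 1.5875 * Real.log 2 ∧
    Real.log 5 ≤ 2.325 * Real.log 2 ∧ 2.32 * Real.log 2 ≤ Real.log 5 ∧
    Real.log 7 ≤ 2.8125 * Real.log 2 := by
  have h1 := mul_log_le_of_pow_le (a := 2) (b := 3) (k := 79) (l := 50) (by norm_num) (by norm_num)
  have h2 := mul_log_le_of_pow_le (a := 3) (b := 2) (k := 80) (l := 127) (by norm_num) (by norm_num)
  have h3 := mul_log_le_of_pow_le (a := 5) (b := 2) (k := 40) (l := 93) (by norm_num) (by norm_num)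
  have h4 := mul_log_le_of_pow_le (a := 2) (b := 5) (k := 58) (l := 25) (by norm_num) (by norm_num)
  have h5 := mul_log_le_of_pow_le (a := 7) (b := 2) (k := 16) (l := 45) (by norm_num) (by norm_num)
  push_cast at h1 h2 h3 h4 h5
  refine ⟨?_, ?_, ?_, ?_, ?_⟩ <;> linarith

/-- The factor `5 / 6` is the mass left when all of `T₂` is chosen with probability `1 / 6`. The
uniform weighting of the five up-sets would fail for the root alone, which explains the larger
weight `1 / 4` on the up-set containing it. -/
theorem entropy_veeTrace (q : Bool × Bool × Bool) :
    Real.log 14 / 6 * veeCard q ≤ 5 / 6 * entropy (pushWeight (veeTrace q) veeWeight) := by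
  have e14 := log_fourteen_eq
  have e1 : Real.log 4 = 2 * Real.log 2 := by
    rw [show (4 : ℝ) = 2 ^ 2 by norm_num, Real.log_pow]; norm_num
  have e2 : Real.log (3 / 16) = Real.log 3 - 4 * Real.log 2 := by
    rw [Real.log_div (by norm_num) (by norm_num), show (16 : ℝ) = 2 ^ 4 by norm_num, Real.log_pow]
    norm_num
  have e3 : Real.log (3 / 8) = Real.log 3 - 3 * Real.log 2 := by
    rw [Real.log_div (by norm_num) (by norm_num), show (8 : ℝ) = 2 ^ 3 by norm_num, Real.log_pow]
    norm_num
  have e4 : Real.log (5 / 8) = Real.log 5 - 3 * Real.log 2 := by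
    rw [Real.log_div (by norm_num) (by norm_num), show (8 : ℝ) = 2 ^ 3 by norm_num, Real.log_pow]
    norm_num
  have e5 : Real.log (7 / 16) = Real.log 7 - 4 * Real.log 2 := by
    rw [Real.log_div (by norm_num) (by norm_num), show (16 : ℝ) = 2 ^ 4 by norm_num, Real.log_pow]
    norm_num
  have e6 : Real.log (3 / 4) = Real.log 3 - 2 * Real.log 2 := by
    rw [Real.log_div (by norm_num) (by norm_num), show (4 : ℝ) = 2 ^ 2 by norm_num, Real.log_pow]
    norm_num
  obtain ⟨b1, b2, b3, b4, b5⟩ := log_bounds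
  have b0 := Real.log_pos (one_lt_two (α := ℝ))
  rw [entropy_pushWeight, e14]
  obtain ⟨q0, q1, q2⟩ := q
  simp only [pushWeight, Fin.sum_univ_five]
  cases q0 <;> cases q1 <;> cases q2 <;>
    simp [veeTrace, veeCard, inRoot, inLeaf₁, inLeaf₂, veeWeight] <;>
    norm_num [e1, e2, e3, e4, e5, e6] <;> linarith

theorem log_fourteen_le_negMulLog :
    Real.log 14 / 6 ≤ Real.negMulLog (1 / 6) + Real.negMulLog (1 - 1 / 6) := by
  have e1 : Real.log (1 / 6) = -(Real.log 2 + Real.log 3) := by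
    rw [Real.log_div (by norm_num) (by norm_num), Real.log_one,
      show (6 : ℝ) = 2 * 3 by norm_num, Real.log_mul (by norm_num) (by norm_num)]
    ring
  have e2 : Real.log (5 / 6) = Real.log 5 - (Real.log 2 + Real.log 3) := by
    rw [Real.log_div (by norm_num) (by norm_num),
      show (6 : ℝ) = 2 * 3 by norm_num, Real.log_mul (by norm_num) (by norm_num)]
  obtain ⟨b1, b2, b3, b4, b5⟩ := log_bounds
  have b0 := Real.log_pos (one_lt_two (α := ℝ))
  rw [log_fourteen_eq, show (1 - 1 / 6 : ℝ) = 5 / 6 by norm_num, Real.negMulLog, Real.negMulLog,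
    e1, e2]
  linarith

instance : Nonempty BinTree := ⟨.A⟩

/-- Membership in the up-set of `T₂` that is everything, or the union of two up-sets of the
two copies of `V` above the root. -/
def binTreeMem (ω : Bool × (Fin 5 × Fin 5)) : BinTree → Bool
  | .A => ω.1
  | .B => ω.1 || inRoot ω.2.1
  | .C => ω.1 || inLeaf₁ ω.2.1
  | .D => ω.1 || inLeaf₂ ω.2.1
  | .E => ω.1 || inRoot ω.2.2
  | .F => ω.1 || inLeaf₁ ω.2.2
  | .G => ω.1 || inLeaf₂ ω.2.2

theorem binTreeMem_mono {ω : Bool × (Fin 5 × Fin 5)} {x y : BinTree} (hxy : x ≤ y)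
    (h : binTreeMem ω x = true) : binTreeMem ω y = true := by
  have hroot : ∀ a, (inRoot a → inLeaf₁ a) ∧ (inRoot a → inLeaf₂ a) := by decide
  change BinTree.le x y = true at hxy
  obtain ⟨r, a, b⟩ := ω
  have ha := hroot a
  have hb := hroot b
  cases r
  · cases x <;> cases y <;> simp_all [binTreeMem, BinTree.le]
  · cases y <;> rfl

/-- The antichain of minimal elements of the up-set given by `binTreeMem`. -/
noncomputable def binTreeAntichain (ω : Bool × (Fin 5 × Fin 5)) :
    antichains (Finset.univ : Finset BinTree) :=
  ⟨shadow Finset.univ (Finset.univ.filter fun x => binTreeMem ω x = true),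
    shadow_mem_antichains _ _⟩

theorem inUp_binTreeAntichain {ω : Bool × (Fin 5 × Fin 5)} {x : BinTree} :
    InUp (binTreeAntichain ω : Finset BinTree) x ↔ binTreeMem ω x = true := by
  rw [binTreeAntichain, inUp_shadow (Finset.mem_univ x)]
  constructor
  · rintro ⟨y, hy, hyx⟩
    exact binTreeMem_mono hyx (Finset.mem_filter.1 hy).2
  · exact fun h => ⟨x, by simpa using h, le_rfl⟩

theorem BinTree.forall_iff {p : BinTree → Prop} :
    (∀ x, p x) ↔ p .A ∧ (p .B ∧ p .C ∧ p .D) ∧ (p .E ∧ p .F ∧ p .G) := by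
  refine ⟨fun h => ⟨h _, ⟨h _, h _, h _⟩, h _, h _, h _⟩, fun h x => ?_⟩
  obtain ⟨hA, ⟨hB, hC, hD⟩, hE, hF, hG⟩ := h
  cases x <;> assumption

theorem shadowIn_binTreeAntichain_iff {Q : Finset BinTree} {ω ω' : Bool × (Fin 5 × Fin 5)} :
    shadowIn Q (binTreeAntichain ω) = shadowIn Q (binTreeAntichain ω') ↔
      ∀ x, x ∈ Q → binTreeMem ω x = binTreeMem ω' x := by
  simp only [shadowIn_eq_iff, inUp_binTreeAntichain, Bool.coe_iff_coe]

/-- The witness takes the whole of `T₂` with probability `1 / 6`, and otherwise independent random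
up-sets of the two copies of `V` above the root. The value `1 / 6` is large enough for the coin's
entropy to pay for the root and small enough to leave the copies of `V` sufficient entropy. -/
theorem log_fourteen_le_criticalExponent :
    Real.log 14 / 6 ≤ criticalExponent BinTree := by
  classical
  let ν : Fin 5 × Fin 5 → ℝ := fun ω => veeWeight ω.1 * veeWeight ω.2
  have hν : ν ∈ stdSimplex ℝ (Fin 5 × Fin 5) := by
    refine ⟨fun ω => mul_nonneg (veeWeight_mem_stdSimplex.1 _) (veeWeight_mem_stdSimplex.1 _), ?_⟩
    simp only [ν, Fintype.sum_prod_type, ← Finset.mul_sum, veeWeight_mem_stdSimplex.2, mul_one]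
  have hw := bernoulliMix_mem_stdSimplex (t := 1 / 6) (by norm_num) (by norm_num) hν
  refine (isLUB_criticalExponent BinTree).1 ⟨?_, pushWeight binTreeAntichain (bernoulliMix (1 / 6) ν),
    pushWeight_mem_stdSimplex _ hw, fun Q hQ => ?_⟩
  · exact div_nonneg (Real.log_nonneg (by norm_num)) (by norm_num)
  have hQpos : (0 : ℝ) < Q.card := by exact_mod_cast Finset.card_pos.2 hQ
  rw [criticalExponentIn, le_div_iff₀ hQpos, inducedWeighting_eq_pushWeight, pushWeight_pushWeight]
  let q₁ : Bool × Bool × Bool := (decide (.B ∈ Q), decide (.C ∈ Q), decide (.D ∈ Q))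
  let q₂ : Bool × Bool × Bool := (decide (.E ∈ Q), decide (.F ∈ Q), decide (.G ∈ Q))
  have hcard : (Q.card : ℝ) = (if BinTree.A ∈ Q then 1 else 0) + veeCard q₁ + veeCard q₂ := by
    have h1 : Q.card = ∑ x : BinTree, if x ∈ Q then 1 else 0 := by
      rw [← Finset.card_filter]
      simp
    have h2 : ∀ u : BinTree → ℕ, ∑ x, u x =
        u .A + (u .B + u .C + u .D) + (u .E + u .F + u .G) := fun u => by
      change ∑ x ∈ ({.A, .B, .C, .D, .E, .F, .G} : Finset BinTree), u x = _
      repeat rw [Finset.sum_insert (by decide)]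
      rw [Finset.sum_singleton]
      ring
    rw [h1, h2]
    have h3 : ∀ x, (decide (x ∈ Q)).toNat = if x ∈ Q then 1 else 0 := fun x => by
      by_cases h : x ∈ Q <;> simp [h]
    simp only [veeCard, q₁, q₂, h3]
    push_cast
    rfl
  -- In the `false` branch the root is never in the up-set, so the trace on `Q` is a pair of
  -- independent traces and its entropy splits.
  have hfib : ∀ a a' b b', shadowIn Q (binTreeAntichain (false, (a, b))) =
      shadowIn Q (binTreeAntichain (false, (a', b'))) ↔
      veeTrace q₁ a = veeTrace q₁ a' ∧ veeTrace q₂ b = veeTrace q₂ b' := by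
    intro a a' b b'
    rw [shadowIn_binTreeAntichain_iff, BinTree.forall_iff]
    have hand : ∀ (x : BinTree) (s t : Bool), (x ∈ Q → s = t) ↔
        ((decide (x ∈ Q) && s) = (decide (x ∈ Q) && t)) := by
      intro x s t
      by_cases h : x ∈ Q <;> simp [h]
    simp [hand, binTreeMem, veeTrace, q₁, q₂]
  have hprod := entropy_pushWeight_prod (γ := fun ω => shadowIn Q (binTreeAntichain (false, ω)))
    hfib veeWeight_mem_stdSimplex veeWeight_mem_stdSimplex
  have h1 := entropy_veeTrace q₁
  have h2 := entropy_veeTrace q₂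
  rw [hcard]
  -- If the root is in `Q`, the trace reveals the coin and the chain rule pays for the root;
  -- otherwise concavity suffices.
  by_cases hA : BinTree.A ∈ Q
  · have h3 := le_entropy_bernoulliMix_of_ne (γ := fun ω => shadowIn Q (binTreeAntichain ω))
      (fun a b h => by
        have := shadowIn_binTreeAntichain_iff.1 h .A hA
        simp [binTreeMem] at this) (t := 1 / 6) (by norm_num) hν
    rw [hprod] at h3
    have h4 := log_fourteen_le_negMulLog
    rw [if_pos hA]
    linarith
  · have h3 := le_entropy_bernoulliMix (fun ω => shadowIn Q (binTreeAntichain ω)) (t := 1 / 6)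
      (by norm_num) (by norm_num) hν
    rw [hprod] at h3
    rw [if_neg hA]
    linarith

end BinTreeExponent

/-! ### The Ramsey threshold -/

theorem criticalExponent_binTree_pos : 0 < criticalExponent BinTree :=
  lt_of_lt_of_le (div_pos (Real.log_pos (by norm_num)) (by norm_num))
    log_fourteen_le_criticalExponent

theorem holdsWhp_isRamsey_vee {c : ℝ} (hc : 0 < c) (h : c < criticalExponent BinTree) :
    HoldsWhp c hc fun _ => {R | IsRamsey Vee Vee R} := by
  obtain ⟨c', ⟨-, α, hα, hQ⟩, hcc', -⟩ := (isLUB_criticalExponent BinTree).exists_between h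
  refine (holdsWhp_hasCopy hc hcc' hα hQ).mono fun n R hR => ?_
  obtain ⟨φ, hinj, hmem⟩ := hR
  refine isRamsey_vee_of_binTree ⟨fun x => (⟨φ x, hmem x⟩ : R), fun x y hxy => φ.monotone hxy⟩ ?_
  exact fun x y hxy => hinj (congrArg Subtype.val hxy)

theorem holdsWhp_not_isRamsey_vee {c : ℝ} (hc : 0 < c) (h : criticalExponent BinTree < c) :
    HoldsWhp c hc fun _ => {R | ¬ IsRamsey Vee Vee R} := by
  have hlow := log_fourteen_le_criticalExponent.trans_lt h
  have h8 : Real.log (8 : ℕ) / (5 : ℕ) < c := by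
    refine lt_of_le_of_lt ?_ hlow
    -- `8 ^ 6 ≤ 14 ^ 5`, so `doubleTree` disappears no later than the bound for `sharedTree`.
    have := mul_log_le_of_pow_le (a := 8) (b := 14) (k := 6) (l := 5) (by norm_num) (by norm_num)
    push_cast at this ⊢
    linarith
  have h1 := holdsWhp_not_hasCopy BinTree hc h (isLUB_criticalExponent BinTree).bddAbove
  have h2 := holdsWhp_not_realises (by norm_num) sharedTree card_upset_sharedTree hc
    (by exact_mod_cast hlow)
  have h3 := holdsWhp_not_realises (by norm_num) doubleTree card_upset_doubleTree hc h8
  refine ((h1.inter h2).inter h3).mono fun n R hR hRam => ?_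
  rcases hRam.binTree_or with ⟨φ, hinj⟩ | hs | hd
  · exact hR.1.1 ⟨⟨fun x => φ x, fun x y hxy => φ.monotone hxy⟩,
      Subtype.val_injective.comp hinj, fun x => (φ x).2⟩
  · exact hR.1.2 hs
  · exact hR.2 hd

theorem HoldsWhp.not_of_not {c : ℝ} {hc hc' : 0 < c}
    {E : ∀ n : ℕ, Set (Set (Finset (Fin n)))} (h : HoldsWhp c hc E) :
    ¬ HoldsWhp c hc' fun n => (E n)ᶜ := by
  intro h'
  have h1 := h.inter h'
  simp only [HoldsWhp, Set.inter_compl_self, measureReal_empty] at h1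
  exact zero_ne_one (tendsto_nhds_unique tendsto_const_nhds h1)

/-- A threshold is the critical Ramsey exponent. -/
theorem isCriticalRamseyExponent_of_holdsWhp {P Q : Type*} [PartialOrder P] [PartialOrder Q] {c₀ : ℝ}
    (hpos : 0 < c₀) (hlow : ∀ c (hc : 0 < c), c < c₀ → HoldsWhp c hc fun _ => {R | IsRamsey P Q R})
    (hupp : ∀ c (hc : 0 < c), c₀ < c → HoldsWhp c hc fun _ => {R | ¬ IsRamsey P Q R}) :
    IsCriticalRamseyExponent P Q c₀ := by
  refine ⟨⟨?_, ?_⟩, ?_, ?_⟩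
  · rintro c ⟨hc, hR⟩
    by_contra! hlt
    exact hR.not_of_not (hupp c hc hlt)
  · intro b hb
    by_contra! hlt
    -- The maximum with 0 is needed because the candidate bound `b` may be negative, while exponents
    -- must be positive.
    obtain ⟨c, hbc, hc⟩ := exists_between (max_lt hlt hpos)
    have h0 : 0 < c := (le_max_right _ _).trans_lt hbc
    exact absurd (hb ⟨h0, hlow c h0 hc⟩) (not_le_of_gt ((le_max_left _ _).trans_lt hbc))
  · rintro c ⟨hc, hR⟩
    by_contra! hlt
    exact (hlow c hc hlt).not_of_not hR
  · intro b hb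
    by_contra! hlt
    obtain ⟨c, hc, hcb⟩ := exists_between hlt
    exact absurd (hb ⟨hpos.trans hc, hupp c _ hc⟩) (not_le_of_gt hcb)

theorem holdsWhp_image_compl_iff {c : ℝ} {hc : 0 < c} (E : ∀ n : ℕ, Set (Set (Finset (Fin n)))) :
    (HoldsWhp c hc fun n => {R | compl '' R ∈ E n}) ↔ HoldsWhp c hc E := by
  simp only [HoldsWhp, randomPoset_real_image_compl]

end RandomPoset

theorem mainTheorem7 :
    RandomPoset.IsCriticalRamseyExponent RandomPoset.Vee RandomPoset.Vee
      (RandomPoset.criticalExponent RandomPoset.BinTree) ∧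
    RandomPoset.IsCriticalRamseyExponent RandomPoset.Wedge RandomPoset.Wedge
      (RandomPoset.criticalExponent RandomPoset.BinTree) := by
  open RandomPoset in
  refine ⟨isCriticalRamseyExponent_of_holdsWhp criticalExponent_binTree_pos
    (fun c hc h => holdsWhp_isRamsey_vee hc h) (fun c hc h => holdsWhp_not_isRamsey_vee hc h),
    isCriticalRamseyExponent_of_holdsWhp criticalExponent_binTree_pos (fun c hc h => ?_)
    (fun c hc h => ?_)⟩
  · simp only [isRamsey_wedge_iff]
    exact (holdsWhp_image_compl_iff fun n => {R | IsRamsey Vee Vee R}).2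
      (holdsWhp_isRamsey_vee hc h)
  · simp only [isRamsey_wedge_iff]
    exact (holdsWhp_image_compl_iff fun n => {R | ¬ IsRamsey Vee Vee R}).2
      (holdsWhp_not_isRamsey_vee hc h)
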